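/- **Setting.** Let $(\Omega,\Upsilon,P)$ be a probability space, $(\mathcal X,\mathcal A)$ a measurable space, $X_{i,n}:\Omega\to\mathcal X$ ($1\le i\le n$, $n\in\mathbb N$) an array of random variables and $\mathcal F$ a family of measurable maps $\mathcal X\to\mathbb R$. Assume that $\mathcal F$ has a finite measurable envelope $F:\mathcal X\to\mathbb R$, i.e. $\sup_{f\in\mathcal F}|f(x)|\le F(x)<\infty$ for all $x$, with $\mathrm E\,F(X_{i,n})<\infty$ for all $1\le i\le n$. Let $\rho$ be a semimetric on $\mathcal F$ (distinct points may have distance $0$) and put $\mathcal F_\delta=\{f-g : f,g\in\mathcal F,\ \rho(f,g)\le\delta\}$, $$S_{n,i,j}(f)=\sum_{k=i}^{j}\bigl(f(X_{k,n})-\mathrm E f(X_{k,n})\bigr),\qquad \mathbb Z_n(t,f)=\frac1{\sqrt n}\,S_{n,1,\lfloor nt\rfloor}(f),\quad (t,f)\in[0,1]\times\mathcal F .$$ By the envelope condition, $\mathbb Z_n$ is a (possibly nonmeasurable) map into $\ell^\infty([0,1]\times\mathcal F)$. For $Y:\Omega\to[-\infty,\infty]$, let $\mathrm E^*Y=\inf\{\mathrm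 E U : U\ge Y,\ U:\Omega\to[-\infty,\infty]\text{ measurable},\ \mathrm E U\text{ exists}\}$ be the outer expectation, and let $P^*$ be the outer probability. Weak convergence $\mathbb Z_n\Rightarrow\mathbb Z$ to a Borel measurable $\mathbb Z$ in $\ell^\infty([0,1]\times\mathcal F)$ means $\mathrm E^*\varphi(\mathbb Z_n)\to\mathrm E\varphi(\mathbb Z)$ for all bounded continuous $\varphi$; the limit may live on another probability space. For $\alpha>1$, a function $g:\mathbb N\to\mathbb R$ on $\mathbb N=\{1,2,\dots\}$ and $Q\in[1,2^{(\alpha-1)/\alpha})$, say that $(\alpha,g)$ fulfills (S) with index $Q$ if $g\ge0$, $g$ is nondecreasing, and $g(i)+g(j-i)\le Q\,g(j)$ for all $1\le i<j$. **Statement.** Let $\nu>2$ and let $(\mathcal F,\rho)$ be totally bounded. Let $\kappa\in(0,\tfrac12-\tfrac1\nu)$, $C\ge0$ and $R,J:(0,\infty)\to[0,\infty)$ with $\lim_{\delta\downarrow0}R(\delta)=0$, and put $$\gamma(m,\delta)=C\,m\,\bigl(R(\delta)+J(\delta)m^{-\kappa}\bigr)^2 .$$ Suppose that for all $\delta>0$,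 $n\in\mathbb N$ and $1\le i\le j\le n$, $$\mathrm E^*\Bigl\{\sup_{f\in\mathcal F_\delta}|S_{n,i,j}(f)|^\nu\Bigr\}\le\gamma(j-i+1,\delta)^{\nu/2},$$ and that there are $f_0\in\mathcal F$ and $D>0$ with $$\|S_{n,i,j}(f_0)\|_{L_\nu}\le D\sqrt{j-i+1}\qquad\text{for all } n\in\mathbb N,\ 1\le i\le j\le n .$$ Then the following hold. (a) There are $g:\mathbb N\times(0,\infty)\to\mathbb R$ and $h:\mathbb N\to\mathbb R$ (with the convention $h(0)=0$) such that 1. $\mathrm E^*\{\sup_{f\in\mathcal F_\delta}|S_{n,i,j}(f)|^\nu\}\le g(j-i+1,\delta)^{\nu/2}$ for all $\delta>0$, $n\in\mathbb N$, $1\le i\le j\le n$, and there is one $Q_g\in[1,2^{1-2/\nu})$ such that for every $\delta>0$ the pair $(\nu/2,g(\cdot,\delta))$ fulfills (S) with index $Q_g$; 2. $\mathrm E^*\{\sup_{f\in\mathcal F}|S_{n,i,j}(f)|^\nu\}\le h(j-i+1)^{\nu/2}$ for all $n\in\mathbb N$, $1\le i\le j\le n$, and $(\nu/2,h)$ fulfills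 (S) with some index $Q_h\in[1,2^{1-2/\nu})$; 3. $\lim_{\delta\downarrow0}\limsup_{n\to\infty}g(n,\delta)/n=0$; 4. there is a constant $C'\ge0$ with $\limsup_{n\to\infty}h(\lfloor n\varepsilon\rfloor)/n\le C'\varepsilon$ for every $0<\varepsilon\le1$. (b) With $\tau((s,f),(t,g))=|s-t|+\rho(f,g)$, for every $\varepsilon>0$, $$\lim_{\delta\downarrow0}\limsup_{n\to\infty}P^*\Bigl(\sup_{\tau((s,f),(t,g))\le\delta}|\mathbb Z_n(s,f)-\mathbb Z_n(t,g)|>\varepsilon\Bigr)=0 .$$ (c) Convergence of the finite-dimensional distributions of $\mathbb Z_n$ implies weak convergence in $\ell^\infty([0,1]\times\mathcal F)$: if for every finite $I\subset[0,1]\times\mathcal F$ the law of $(\mathbb Z_n(p))_{p\in I}$ converges weakly to some probability measure $\mu_I$ on $\mathbb R^I$, then there is a tight Borel measurable $\mathbb Z$ in $\ell^\infty([0,1]\times\mathcal F)$ with marginal laws $\mu_I$ and $\mathbb Z_n\Rightarrow\mathbb Z$; and whenever the finite-dimensional distributions of $\mathbb Z_n$ converge weakly to those of a given tight Borel measurable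 $\mathbb Z$, then $\mathbb Z_n\Rightarrow\mathbb Z$. -/

import Mathlib

open MeasureTheory Filter Topology Set
open scoped ENNReal BoundedContinuousFunction

noncomputable section

namespace SeqEmp

/-! ### Outer expectations -/

/-- The expectation of `U` exists in the extended reals: at least one of `E U⁺`, `E U⁻` is finite. -/
def HasExpectation {Ω : Type*} [MeasurableSpace Ω] (P : Measure Ω) (U : Ω → EReal) : Prop :=
  (∫⁻ ω, (U ω).toENNReal ∂P) ≠ ⊤ ∨ (∫⁻ ω, (-U ω).toENNReal ∂P) ≠ ⊤

/-- The expectation `E U = E U⁺ - E U⁻` of an extended real valued map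
(used only for measurable `U` whose expectation exists). -/
def expectation {Ω : Type*} [MeasurableSpace Ω] (P : Measure Ω) (U : Ω → EReal) : EReal :=
  ((∫⁻ ω, (U ω).toENNReal ∂P : ℝ≥0∞) : EReal) - ((∫⁻ ω, (-U ω).toENNReal ∂P : ℝ≥0∞) : EReal)

/-- The outer expectation `E* Y` of an arbitrary, possibly nonmeasurable map `Y`: the infimum of
`E U` over all measurable `U ≥ Y` whose expectation exists. -/
def outerExpectation {Ω : Type*} [MeasurableSpace Ω] (P : Measure Ω) (Y : Ω → EReal) : EReal :=
  sInf {e : EReal | ∃ U : Ω → EReal,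
    Measurable U ∧ (∀ ω, Y ω ≤ U ω) ∧ HasExpectation P U ∧ e = expectation P U}

/-! ### Semimetrics -/

/-- A semimetric (distinct points may have distance zero). -/
structure IsSemimetric {S : Type*} (ρ : S → S → ℝ) : Prop where
  nonneg : ∀ x y, 0 ≤ ρ x y
  self : ∀ x, ρ x x = 0
  symm : ∀ x y, ρ x y = ρ y x
  triangle : ∀ x y z, ρ x z ≤ ρ x y + ρ y z

/-- `(S, ρ)` is totally bounded: finitely many open `ε`-balls cover `S`, for every `ε > 0`. -/
def IsTotallyBounded {S : Type*} (ρ : S → S → ℝ) : Prop :=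
  ∀ ε : ℝ, 0 < ε → ∃ t : Finset S, ∀ x, ∃ y ∈ t, ρ x y < ε

/-! ### The array, its partial sums and the sequential empirical process

The array is `X n i`, for `1 ≤ i ≤ n`; values at other indices are never used. -/

/-- `Fenv` is a finite measurable envelope of `F` with `E Fenv(X n i) < ∞`. -/
structure IsEnvelope {Ω 𝒳 : Type*} [MeasurableSpace Ω] [MeasurableSpace 𝒳] (P : Measure Ω)
    (X : ℕ → ℕ → Ω → 𝒳) (F : Set (𝒳 → ℝ)) (Fenv : 𝒳 → ℝ) : Prop where
  measurable : Measurable Fenv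
  bound : ∀ f ∈ F, ∀ x, |f x| ≤ Fenv x
  integrable : ∀ n i, 1 ≤ i → i ≤ n → Integrable (fun ω => Fenv (X n i ω)) P

/-- The centered partial sum `∑_{k=i}^{j} (g(X n k) - E g(X n k))` (zero for `j < i`). -/
def partialSum {Ω 𝒳 : Type*} [MeasurableSpace Ω] (P : Measure Ω) (X : ℕ → ℕ → Ω → 𝒳)
    (n i j : ℕ) (g : 𝒳 → ℝ) (ω : Ω) : ℝ :=
  ∑ k ∈ Finset.Icc i j, (g (X n k ω) - ∫ ω', g (X n k ω') ∂P)

/-- The class `F_δ = {f - g | f, g ∈ F, ρ(f, g) ≤ δ}`. -/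
def differenceClass {𝒳 : Type*} (F : Set (𝒳 → ℝ)) (ρ : F → F → ℝ) (δ : ℝ) : Set (𝒳 → ℝ) :=
  {u | ∃ f g : F, ρ f g ≤ δ ∧ u = fun x => f.1 x - g.1 x}

/-- `E* sup_{f ∈ H} |S_{n,i,j}(f)|^ν`. -/
def outerSupMoment {Ω 𝒳 : Type*} [MeasurableSpace Ω] (P : Measure Ω) (X : ℕ → ℕ → Ω → 𝒳)
    (H : Set (𝒳 → ℝ)) (ν : ℝ) (n i j : ℕ) : EReal :=
  outerExpectation P (fun ω => ⨆ f ∈ H, ((|partialSum P X n i j f ω| ^ ν : ℝ) : EReal))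

/-- The sequential empirical process
`Z_n(t, f) = n^{-1/2} ∑_{i=1}^{⌊nt⌋} (f(X n i) - E f(X n i))`, `(t, f) ∈ [0,1] × F`. -/
def seqProcess {Ω 𝒳 : Type*} [MeasurableSpace Ω] (P : Measure Ω) (X : ℕ → ℕ → Ω → 𝒳)
    (F : Set (𝒳 → ℝ)) (n : ℕ) (ω : Ω) (p : Icc (0 : ℝ) 1 × F) : ℝ :=
  (1 / √(n : ℝ)) * partialSum P X n 1 ⌊(n : ℝ) * p.1.1⌋₊ p.2.1 ω

/-- The semimetric `τ((s,f),(t,g)) = |s - t| + ρ(f,g)` on `[0,1] × F`. -/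
def productSemimetric {𝒳 : Type*} {F : Set (𝒳 → ℝ)} (ρ : F → F → ℝ)
    (p q : Icc (0 : ℝ) 1 × F) : ℝ :=
  |p.1.1 - q.1.1| + ρ p.2 q.2

/-- Asymptotic uniform equicontinuity in (outer) probability with respect to `τ`. A `Measure`
evaluated at an arbitrary set is the induced outer measure, so `P` below is `P*`. -/
def AEC {Ω T : Type*} [MeasurableSpace Ω] (P : Measure Ω) (Z : ℕ → Ω → T → ℝ)
    (τ : T → T → ℝ) : Prop :=
  ∀ ε : ℝ, 0 < ε → Tendsto
    (fun δ : ℝ => limsup (fun n : ℕ =>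
      P {ω | (ε : EReal) < ⨆ (p : T) (q : T) (_ : τ p q ≤ δ), ((|Z n ω p - Z n ω q| : ℝ) : EReal)})
      atTop)
    (𝓝[>] 0) (𝓝 0)

/-! ### Weak convergence in `ℓ^∞(T)` -/

/-- `ℓ^∞(T)`: the bounded real functions on `T` with the supremum norm. -/
abbrev EllInfty (T : Type*) : Type _ := lp (fun _ : T => ℝ) ∞

/-- `ℓ^∞(T)` carries the Borel `σ`-field of the supremum norm. -/
instance {T : Type*} : MeasurableSpace (EllInfty T) := borel _

instance {T : Type*} : BorelSpace (EllInfty T) := ⟨rfl⟩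

/-- The paths of the sequential empirical process are bounded when there is an envelope. -/
theorem memlp_seqProcess {Ω 𝒳 : Type*} [MeasurableSpace Ω] [MeasurableSpace 𝒳] {P : Measure Ω}
    {X : ℕ → ℕ → Ω → 𝒳} {F : Set (𝒳 → ℝ)} {Fenv : 𝒳 → ℝ} (hF : IsEnvelope P X F Fenv)
    (n : ℕ) (ω : Ω) : Memℓp (seqProcess P X F n ω) ∞ := by
  refine memℓp_infty ⟨(1 / √(n : ℝ)) * ∑ k ∈ Finset.Icc 1 n,
    |Fenv (X n k ω)| + (1 / √(n : ℝ)) * ∑ k ∈ Finset.Icc 1 n, |∫ ω', Fenv (X n k ω') ∂P|, ?_⟩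
  rintro _ ⟨⟨t, f⟩, rfl⟩
  have hfl : ⌊(n : ℝ) * t.1⌋₊ ≤ n := by
    apply Nat.floor_le_of_le
    have := mul_le_mul_of_nonneg_left t.2.2 (Nat.cast_nonneg (α := ℝ) n)
    simpa using this
  have hc : (0 : ℝ) ≤ 1 / √(n : ℝ) := by positivity
  simp only [seqProcess, partialSum, Real.norm_eq_abs]
  rw [abs_mul, abs_of_nonneg hc, ← mul_add, ← Finset.sum_add_distrib]
  refine mul_le_mul_of_nonneg_left ?_ hc
  refine (Finset.abs_sum_le_sum_abs _ _).trans ?_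
  refine le_trans (Finset.sum_le_sum (g := fun k =>
    |Fenv (X n k ω)| + |∫ ω', Fenv (X n k ω') ∂P|) ?_) ?_
  · intro k hk
    rw [Finset.mem_Icc] at hk
    refine (abs_sub _ _).trans (add_le_add ?_ ?_)
    · exact (hF.bound f.1 f.2 _).trans (le_abs_self _)
    · refine le_trans ?_ (le_abs_self _)
      have := norm_integral_le_of_norm_le (hF.integrable n k hk.1 (hk.2.trans hfl))
        (f := fun ω' => f.1 (X n k ω'))
        (Eventually.of_forall fun ω' => by simpa using hF.bound f.1 f.2 (X n k ω'))
      simpa using this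
  · exact Finset.sum_le_sum_of_subset_of_nonneg (Finset.Icc_subset_Icc_right hfl)
      (fun _ _ _ => by positivity)

/-- The sequential empirical process as a (possibly nonmeasurable) map into `ℓ^∞([0,1] × F)`. -/
def seqProcessEll {Ω 𝒳 : Type*} [MeasurableSpace Ω] [MeasurableSpace 𝒳] {P : Measure Ω}
    {X : ℕ → ℕ → Ω → 𝒳} {F : Set (𝒳 → ℝ)} {Fenv : 𝒳 → ℝ} (hF : IsEnvelope P X F Fenv)
    (n : ℕ) (ω : Ω) : EllInfty (Icc (0 : ℝ) 1 × F) :=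
  ⟨seqProcess P X F n ω, memlp_seqProcess hF n ω⟩

/-- Weak convergence of arbitrary maps `Z n : Ω → ℓ^∞(T)` to a Borel limit with law `L`:
`E* φ(Z n) → ∫ φ dL` for every bounded continuous `φ`. -/
def WeakConv {Ω T : Type*} [MeasurableSpace Ω] (P : Measure Ω) (Z : ℕ → Ω → EllInfty T)
    (L : Measure (EllInfty T)) : Prop :=
  ∀ φ : EllInfty T →ᵇ ℝ, Tendsto
    (fun n => outerExpectation P (fun ω => ((φ (Z n ω) : ℝ) : EReal))) atTop
    (𝓝 ((∫ z, φ z ∂L : ℝ) : EReal))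

/-- The finite-dimensional marginals of `Z n` converge weakly to the laws `μ I`. -/
def FidiConv {Ω T : Type*} [MeasurableSpace Ω] (P : Measure Ω) (Z : ℕ → Ω → T → ℝ)
    (μ : (I : Finset T) → Measure (I → ℝ)) : Prop :=
  ∀ (I : Finset T) (φ : (I → ℝ) →ᵇ ℝ), Tendsto
    (fun n => ∫ ω, φ (fun t : I => Z n ω t) ∂P) atTop (𝓝 (∫ x, φ x ∂(μ I)))

/-- The marginal law at the points of `I` of a law `L` on `ℓ^∞(T)`. -/
def marginal {T : Type*} (L : Measure (EllInfty T)) (I : Finset T) : Measure (I → ℝ) :=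
  L.map (fun (z : EllInfty T) (t : I) => (z : T → ℝ) t)

/-- Finite-dimensional convergence of `Z n` implies weak convergence in `ℓ^∞(T)`: if the marginals
converge weakly to some probability laws, then there is a tight Borel limit with these marginals,
to which `Z n` converges weakly; and if the marginals converge to those of a given tight Borel law,
then `Z n` converges weakly to that law. -/
def FidiImpliesWeak {Ω T : Type*} [MeasurableSpace Ω] (P : Measure Ω)
    (Z : ℕ → Ω → EllInfty T) : Prop :=
  (∀ μ : (I : Finset T) → Measure (I → ℝ), (∀ I, IsProbabilityMeasure (μ I)) →
    FidiConv P (fun n ω => (Z n ω : T → ℝ)) μ →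
    ∃ L : Measure (EllInfty T), IsProbabilityMeasure L ∧ IsTightMeasureSet {L} ∧
      (∀ I, marginal L I = μ I) ∧ WeakConv P Z L) ∧
  (∀ L : Measure (EllInfty T), IsProbabilityMeasure L → IsTightMeasureSet {L} →
    FidiConv P (fun n ω => (Z n ω : T → ℝ)) (marginal L) → WeakConv P Z L)

/-! ### The moment conditions -/

/-- The growth condition on the pair `(α, g)` with index `Q ∈ [1, 2^{(α-1)/α})`;
`g` is a function of `m ≥ 1`. -/
structure ConditionS (α : ℝ) (g : ℕ → ℝ) (Q : ℝ) : Prop where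
  one_le : 1 ≤ Q
  lt : Q < (2 : ℝ) ^ ((α - 1) / α)
  nonneg : ∀ m, 1 ≤ m → 0 ≤ g m
  mono : ∀ m m', 1 ≤ m → m ≤ m' → g m ≤ g m'
  add_le : ∀ i j, 1 ≤ i → i < j → g i + g (j - i) ≤ Q * g j

/-- The four conditions of the general equicontinuity theorem, for the bounding functions
`g(m, δ)` and `h(m)`. -/
structure MomentConditions {Ω 𝒳 : Type*} [MeasurableSpace Ω] (P : Measure Ω)
    (X : ℕ → ℕ → Ω → 𝒳) (F : Set (𝒳 → ℝ)) (ρ : F → F → ℝ) (ν : ℝ)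
    (g : ℕ → ℝ → ℝ) (h : ℕ → ℝ) : Prop where
  bound_diff : ∀ (n : ℕ) (δ : ℝ), 0 < δ → ∀ i j, 1 ≤ i → i ≤ j → j ≤ n →
    outerSupMoment P X (differenceClass F ρ δ) ν n i j ≤ ((g (j - i + 1) δ ^ (ν / 2) : ℝ) : EReal)
  condS_diff : ∃ Q : ℝ, ∀ δ : ℝ, 0 < δ → ConditionS (ν / 2) (fun m => g m δ) Q
  bound_all : ∀ n i j : ℕ, 1 ≤ i → i ≤ j → j ≤ n →
    outerSupMoment P X F ν n i j ≤ ((h (j - i + 1) ^ (ν / 2) : ℝ) : EReal)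
  condS_all : ∃ Q : ℝ, ConditionS (ν / 2) h Q
  limit_diff : Tendsto
    (fun δ : ℝ => limsup (fun n : ℕ => ((g n δ / (n : ℝ) : ℝ) : EReal)) atTop) (𝓝[>] 0) (𝓝 0)
  h_zero : h 0 = 0
  limit_all : ∃ C : ℝ, 0 ≤ C ∧ ∀ ε : ℝ, 0 < ε → ε ≤ 1 →
    limsup (fun n : ℕ => ((h ⌊(n : ℝ) * ε⌋₊ / (n : ℝ) : ℝ) : EReal)) atTop ≤ ((C * ε : ℝ) : EReal)

/-- `γ(m, δ) = C m (R(δ) + J(δ) m^{-κ})²`. -/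
def gammaBound (C κ : ℝ) (R J : ℝ → ℝ) (m : ℕ) (δ : ℝ) : ℝ :=
  C * (m : ℝ) * (R δ + J δ * (m : ℝ) ^ (-κ)) ^ 2

end SeqEmp

end

namespace SeqEmp

/-! ### Outer expectations and measurable majorants -/

section OuterExpectation

variable {Ω : Type*} [MeasurableSpace Ω] {P : Measure Ω}

/-! Outer moment bounds are replaced throughout by `L^ν` bounds on measurable majorants (`DomLp`),
so Minkowski, Markov and finite maxima are available for nonmeasurable suprema. The square root of
`γ(m, δ)` is `A √m + B m^(1/2-κ)` with `A = √C R(δ)`, `B = √C J(δ)`.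

Maximal inequality: halving an interval bounds the maximal partial sum by one sum plus the larger of
two half-size maxima. That larger one costs a factor `2^(1/ν)`, while doubling the length gains at
least `2^(1/2-κ)`. Since `κ < 1/2 - 1/ν` the gain wins, and the maximum obeys the same bound as a
single sum up to a constant (`exists_domLp_iSup_supSum_le`).

Equicontinuity: `Z(s,f) - Z(t,g)` is split at `Z(s,g)`. The change of function is a maximal sum over
`F_δ` of order `R(δ) + J(δ) n^(-κ)`; letting `n → ∞` removes `J`, and then `δ → 0` removes `R`. The
change of time is a maximum over about `1/δ` blocks of length about `nδ`, of order `δ^(-1/ν)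
δ^(1/2)`, which vanishes because `ν > 2`. The moments over all of `F` that this requires come from
`f₀` and from the finite diameter of `F` (`supBound_all`). The growth condition (S) is concavity of
powers (`conditionS_growth_sq`).

Weak convergence: equicontinuity and total boundedness make the process uniformly close to its
projections onto finite nets. Given a tight limit law, finite-dimensional convergence of these
projections passes to `φ(Z n)` (`weakConv_of_fidiConv`). If only the marginals are known, the
projected limit laws are uniformly tight, and a cluster point of them is the limit law
(`exists_tight_law`). -/

theorem exists_measurable_majorant_of_outerExpectation_le {Y : Ω → EReal} (hY : ∀ ω, 0 ≤ Y ω)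
    {b : ℝ} (h : outerExpectation P Y ≤ b) :
    ∃ V : Ω → ℝ≥0∞, Measurable V ∧ (∀ ω, (Y ω).toENNReal ≤ V ω) ∧
      ∫⁻ ω, V ω ∂P ≤ ENNReal.ofReal b := by
  -- Near-optimal majorants with slack `1/(m+1)`: their countable infimum is still measurable and
  -- attains the bound.
  have key : ∀ m : ℕ, ∃ U : Ω → ℝ≥0∞, Measurable U ∧ (∀ ω, (Y ω).toENNReal ≤ U ω) ∧
      ∫⁻ ω, U ω ∂P ≤ ENNReal.ofReal (b + 1 / ((m : ℝ) + 1)) := by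
    intro m
    have hlt : outerExpectation P Y < ((b + 1 / ((m : ℝ) + 1) : ℝ) : EReal) := by
      refine h.trans_lt ?_
      have : (0 : ℝ) < 1 / ((m : ℝ) + 1) := by positivity
      exact_mod_cast (by linarith : b < b + 1 / ((m : ℝ) + 1))
    obtain ⟨e, ⟨U, hU, hYU, -, rfl⟩, he⟩ := sInf_lt_iff.1 hlt
    refine ⟨fun ω => (U ω).toENNReal, hU.ereal_toENNReal,
      fun ω => EReal.toENNReal_le_toENNReal (hYU ω), ?_⟩
    have h0 : ∀ ω, (-U ω).toENNReal = 0 := fun ω =>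
      EReal.toENNReal_of_nonpos (by simpa using (hY ω).trans (hYU ω))
    simp only [expectation, h0, lintegral_zero, EReal.coe_ennreal_zero, sub_zero] at he
    have := EReal.toENNReal_le_toENNReal he.le
    rwa [EReal.toENNReal_coe, EReal.real_coe_toENNReal] at this
  choose U hU hYU hint using key
  refine ⟨fun ω => ⨅ m, U m ω, .iInf hU, fun ω => le_iInf fun m => hYU m ω, ?_⟩
  have hlim : Tendsto (fun m : ℕ => ENNReal.ofReal (b + 1 / ((m : ℝ) + 1))) atTop
      (𝓝 (ENNReal.ofReal b)) := by
    have := (tendsto_one_div_add_atTop_nhds_zero_nat (𝕜 := ℝ)).const_add b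
    rw [add_zero] at this
    exact (ENNReal.continuous_ofReal.tendsto _).comp this
  exact ge_of_tendsto' hlim fun m =>
    (lintegral_mono fun ω => iInf_le _ m).trans (hint m)

theorem expectation_coe_ennreal (V : Ω → ℝ≥0∞) :
    expectation P (fun ω => (V ω : EReal)) = ((∫⁻ ω, V ω ∂P : ℝ≥0∞) : EReal) := by
  have h0 : ∀ ω, (-(V ω : EReal)).toENNReal = 0 := fun ω =>
    EReal.toENNReal_of_nonpos (by simpa using EReal.coe_ennreal_nonneg (V ω))
  simp only [expectation, h0, EReal.toENNReal_coe, lintegral_zero, EReal.coe_ennreal_zero, sub_zero]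

theorem outerExpectation_le_lintegral {Y : Ω → EReal} {V : Ω → ℝ≥0∞} (hV : Measurable V)
    (h : ∀ ω, Y ω ≤ V ω) : outerExpectation P Y ≤ ((∫⁻ ω, V ω ∂P : ℝ≥0∞) : EReal) := by
  refine sInf_le ⟨fun ω => (V ω : EReal), hV.coe_ereal_ennreal, h, Or.inr ?_,
    (expectation_coe_ennreal V).symm⟩
  have h0 : ∀ ω, (-(V ω : EReal)).toENNReal = 0 := fun ω =>
    EReal.toENNReal_of_nonpos (by simpa using EReal.coe_ennreal_nonneg (V ω))
  simp only [h0, lintegral_zero, ne_eq, ENNReal.zero_ne_top, not_false_eq_true]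

end OuterExpectation

/-! ### Outer `L^p` bounds -/

/-- The outer `L^p` norm of `Y` is at most `c`, witnessed by a measurable majorant. -/
def DomLp {Ω : Type*} [MeasurableSpace Ω] (P : Measure Ω) (p : ℝ) (Y : Ω → ℝ≥0∞) (c : ℝ≥0∞) :
    Prop :=
  ∃ W : Ω → ℝ≥0∞, Measurable W ∧ (∀ ω, Y ω ≤ W ω) ∧ (∫⁻ ω, W ω ^ p ∂P) ^ (1 / p) ≤ c

namespace DomLp

variable {Ω : Type*} [MeasurableSpace Ω] {P : Measure Ω} {p : ℝ} {Y Y' : Ω → ℝ≥0∞} {c c' : ℝ≥0∞}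

theorem mono (h : DomLp P p Y c) (hY : ∀ ω, Y' ω ≤ Y ω) (hc : c ≤ c') : DomLp P p Y' c' := by
  obtain ⟨W, hW, hYW, hWc⟩ := h
  exact ⟨W, hW, fun ω => (hY ω).trans (hYW ω), hWc.trans hc⟩

theorem zero (hp : 0 < p) (hY : ∀ ω, Y ω = 0) : DomLp P p Y c :=
  ⟨fun _ => 0, measurable_const, fun ω => (hY ω).le, by simp [hp]⟩

theorem add (hp : 1 ≤ p) (h : DomLp P p Y c) (h' : DomLp P p Y' c') :
    DomLp P p (fun ω => Y ω + Y' ω) (c + c') := by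
  obtain ⟨W, hW, hYW, hWc⟩ := h
  obtain ⟨W', hW', hYW', hWc'⟩ := h'
  exact ⟨W + W', hW.add hW', fun ω => add_le_add (hYW ω) (hYW' ω),
    (ENNReal.lintegral_Lp_add_le hW.aemeasurable hW'.aemeasurable hp).trans (add_le_add hWc hWc')⟩

theorem const_mul (hp : 0 < p) (a : ℝ≥0∞) (h : DomLp P p Y c) :
    DomLp P p (fun ω => a * Y ω) (a * c) := by
  obtain ⟨W, hW, hYW, hWc⟩ := h
  refine ⟨fun ω => a * W ω, hW.const_mul a, fun ω => by dsimp only; gcongr; exact hYW ω, ?_⟩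
  simp_rw [ENNReal.mul_rpow_of_nonneg _ _ hp.le]
  rw [lintegral_const_mul _ (hW.pow_const p), ENNReal.mul_rpow_of_nonneg _ _ (by positivity),
    one_div, ENNReal.rpow_rpow_inv hp.ne']
  gcongr
  simpa using hWc

/-- A maximum is at most the `ℓ^p` sum, so it costs only the `p`-th root of the number of terms. -/
theorem iSup_finset {ι : Type*} (hp : 0 < p) (s : Finset ι) {Y : ι → Ω → ℝ≥0∞}
    (h : ∀ i ∈ s, DomLp P p (Y i) c) :
    DomLp P p (fun ω => ⨆ i ∈ s, Y i ω) ((s.card : ℝ≥0∞) ^ (1 / p) * c) := by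
  classical
  have h' : ∀ i, ∃ W : Ω → ℝ≥0∞, i ∈ s → Measurable W ∧ (∀ ω, Y i ω ≤ W ω) ∧
      (∫⁻ ω, W ω ^ p ∂P) ^ (1 / p) ≤ c := by
    intro i
    by_cases hi : i ∈ s
    · obtain ⟨W, hW⟩ := h i hi
      exact ⟨W, fun _ => hW⟩
    · exact ⟨0, fun hi' => absurd hi' hi⟩
  choose W hW using h'
  have hmeas : Measurable fun ω => ∑ i ∈ s, W i ω ^ p :=
    Finset.measurable_fun_sum s fun i hi => (hW i hi).1.pow_const p
  refine ⟨fun ω => (∑ i ∈ s, W i ω ^ p) ^ (1 / p), hmeas.pow_const _, fun ω => ?_, ?_⟩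
  · refine iSup₂_le fun i hi => ((hW i hi).2.1 ω).trans ?_
    calc W i ω = (W i ω ^ p) ^ (1 / p) := by rw [one_div, ENNReal.rpow_rpow_inv hp.ne']
      _ ≤ (∑ i ∈ s, W i ω ^ p) ^ (1 / p) := by
        gcongr
        exact Finset.single_le_sum (f := fun i => W i ω ^ p) (fun _ _ => zero_le) hi
  · simp_rw [one_div, ENNReal.rpow_inv_rpow hp.ne']
    rw [lintegral_finsetSum' _ fun i hi => ((hW i hi).1.pow_const p).aemeasurable]
    have hle : ∑ i ∈ s, ∫⁻ ω, W i ω ^ p ∂P ≤ (s.card : ℝ≥0∞) * c ^ p := by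
      rw [← nsmul_eq_mul]
      refine Finset.sum_le_card_nsmul _ _ _ fun i hi => ?_
      have := (hW i hi).2.2
      rw [one_div, ENNReal.rpow_inv_le_iff hp] at this
      exact this
    refine (ENNReal.rpow_le_rpow hle (by positivity)).trans ?_
    rw [ENNReal.mul_rpow_of_nonneg _ _ (by positivity), ENNReal.rpow_rpow_inv hp.ne']

theorem max (hp : 0 < p) (h : DomLp P p Y c) (h' : DomLp P p Y' c) :
    DomLp P p (fun ω => Y ω ⊔ Y' ω) ((2 : ℝ≥0∞) ^ (1 / p) * c) := by
  have := iSup_finset (Y := fun b : Bool => if b then Y else Y') hp (Finset.univ : Finset Bool)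
    (c := c) (P := P) (by intro i _; cases i <;> simpa)
  refine this.mono (fun ω => ?_) (by simp)
  simp [iSup_bool_eq]

theorem measure_lt_le (hp : 0 < p) (h : DomLp P p Y c) {ε : ℝ≥0∞} (hε : ε ≠ 0) (hε' : ε ≠ ⊤) :
    P {ω | ε < Y ω} ≤ (c / ε) ^ p := by
  obtain ⟨W, hW, hYW, hWc⟩ := h
  rw [one_div, ENNReal.rpow_inv_le_iff hp] at hWc
  have hsub : {ω | ε < Y ω} ⊆ {ω | ε ^ p ≤ W ω ^ p} := fun ω hω =>
    ENNReal.rpow_le_rpow ((le_of_lt hω).trans (hYW ω)) hp.le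
  refine (measure_mono hsub).trans ?_
  refine (meas_ge_le_lintegral_div (hW.pow_const p).aemeasurable ?_ ?_).trans ?_
  · simp [hε, hε']
  · simp [hε', hp.le]
  · rw [ENNReal.div_rpow_of_nonneg _ _ hp.le]
    gcongr

end DomLp

/-! ### Suprema of partial sums -/

section Sup

variable {Ω 𝒳 : Type*} [MeasurableSpace Ω] {P : Measure Ω} {X : ℕ → ℕ → Ω → 𝒳}

/-- `sup_{f ∈ H} |S_{n,i,j}(f)|` as an extended nonnegative number. -/
noncomputable def supSum (P : Measure Ω) (X : ℕ → ℕ → Ω → 𝒳) (H : Set (𝒳 → ℝ)) (n i j : ℕ)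
    (ω : Ω) : ℝ≥0∞ :=
  ⨆ f ∈ H, ENNReal.ofReal |partialSum P X n i j f ω|

theorem domLp_supSum_of_outerSupMoment_le {H : Set (𝒳 → ℝ)} (hH : H.Nonempty) {ν c : ℝ}
    (hν : 0 < ν) (hc : 0 ≤ c) {n i j : ℕ}
    (h : outerSupMoment P X H ν n i j ≤ ((c ^ ν : ℝ) : EReal)) :
    DomLp P ν (supSum P X H n i j) (ENNReal.ofReal c) := by
  obtain ⟨f₀, hf₀⟩ := hH
  -- Nonemptiness of `H` makes the supremum in `EReal` nonnegative; over the empty class it would be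
  -- `⊥`.
  obtain ⟨V, hV, hYV, hint⟩ := exists_measurable_majorant_of_outerExpectation_le
    (fun ω => le_trans (by positivity) (le_iSup₂_of_le f₀ hf₀ le_rfl)) h
  refine ⟨fun ω => V ω ^ (1 / ν), hV.pow_const _, fun ω => iSup₂_le fun f hf => ?_, ?_⟩
  · rw [one_div, ENNReal.le_rpow_inv_iff hν, ENNReal.ofReal_rpow_of_nonneg (abs_nonneg _) hν.le]
    refine le_trans ?_ (hYV ω)
    rw [← EReal.real_coe_toENNReal]
    exact EReal.toENNReal_le_toENNReal (le_iSup₂_of_le f hf le_rfl)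
  · simp_rw [one_div, ENNReal.rpow_inv_rpow hν.ne']
    rw [ENNReal.rpow_inv_le_iff hν, ENNReal.ofReal_rpow_of_nonneg hc hν.le]
    exact hint

theorem outerSupMoment_le_of_domLp_supSum {H : Set (𝒳 → ℝ)} {ν c : ℝ}
    (hν : 0 < ν) (hc : 0 ≤ c) {n i j : ℕ}
    (h : DomLp P ν (supSum P X H n i j) (ENNReal.ofReal c)) :
    outerSupMoment P X H ν n i j ≤ ((c ^ ν : ℝ) : EReal) := by
  obtain ⟨W, hW, hYW, hWc⟩ := h
  rw [one_div, ENNReal.rpow_inv_le_iff hν, ENNReal.ofReal_rpow_of_nonneg hc hν.le] at hWc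
  have hle : outerSupMoment P X H ν n i j ≤ ((∫⁻ ω, W ω ^ ν ∂P : ℝ≥0∞) : EReal) := by
    refine outerExpectation_le_lintegral (hW.pow_const ν) fun ω => iSup₂_le fun f hf => ?_
    have h1 : ENNReal.ofReal (|partialSum P X n i j f ω| ^ ν) ≤ W ω ^ ν := by
      rw [← ENNReal.ofReal_rpow_of_nonneg (abs_nonneg _) hν.le]
      exact ENNReal.rpow_le_rpow ((le_iSup₂_of_le f hf le_rfl).trans (hYW ω)) hν.le
    calc ((|partialSum P X n i j f ω| ^ ν : ℝ) : EReal)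
        = (ENNReal.ofReal (|partialSum P X n i j f ω| ^ ν) : EReal) := by
          rw [EReal.coe_ennreal_ofReal, max_eq_left (by positivity)]
      _ ≤ _ := EReal.coe_ennreal_le_coe_ennreal_iff.2 h1
  refine hle.trans ((EReal.coe_ennreal_le_coe_ennreal_iff.2 hWc).trans ?_)
  rw [EReal.coe_ennreal_ofReal, max_eq_left (by positivity)]

end Sup

/-! ### A maximal inequality by doubling -/

section Maximal

variable {Ω : Type*} [MeasurableSpace Ω] {P : Measure Ω} {p : ℝ}

/-- Induction by halving: an endpoint in the second half is reached through the midpoint, so the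
maximum is at most the sum over the first half plus the larger of the two half maxima. `hK` says
exactly that the constant `K` reproduces itself. -/
theorem domLp_iSup_le_two_pow {Y : ℕ → ℕ → Ω → ℝ≥0∞} {u : ℕ → ℝ≥0∞} {K : ℝ≥0∞} (hp : 1 ≤ p)
    (hsub : ∀ a b c ω, a ≤ b → b ≤ c → Y a c ω ≤ Y a b ω + Y b c ω) (h0 : ∀ a ω, Y a a ω = 0)
    (hu : ∀ a b, a ≤ b → DomLp P p (Y a b) (u (b - a))) (hK1 : 1 ≤ K)
    (hK : ∀ m, u m + 2 ^ (1 / p) * (K * u m) ≤ K * u (2 * m)) (N a : ℕ) :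
    DomLp P p (fun ω => ⨆ (k : ℕ) (_ : k ≤ 2 ^ N), Y a (a + k) ω) (K * u (2 ^ N)) := by
  have hp0 : 0 < p := by linarith
  induction N generalizing a with
  | zero =>
    have h1 := hu a (a + 1) (by omega)
    rw [Nat.add_sub_cancel_left] at h1
    refine h1.mono (fun ω => iSup₂_le fun k hk => ?_) ?_
    · interval_cases k
      · simp [h0]
      · exact le_rfl
    · simpa using le_mul_of_one_le_left (zero_le) hK1
  | succ N ih =>
    have h1 := hu a (a + 2 ^ N) (Nat.le_add_right _ _)
    rw [Nat.add_sub_cancel_left] at h1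
    refine (h1.add hp ((ih a).max hp0 (ih (a + 2 ^ N)))).mono (fun ω => ?_)
      (by rw [pow_succ']; exact hK _)
    refine iSup₂_le fun k hk => ?_
    rcases le_or_gt k (2 ^ N) with h | h
    · exact le_add_left (le_sup_of_le_left (le_iSup₂_of_le k h le_rfl))
    · obtain ⟨l, rfl⟩ := Nat.exists_eq_add_of_le h.le
      refine (hsub a (a + 2 ^ N) _ ω (Nat.le_add_right _ _) (by omega)).trans ?_
      gcongr
      refine le_sup_of_le_right (le_iSup₂_of_le l ?_ (by rw [add_assoc]))
      rw [pow_succ] at hk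
      omega

/-- For `m > 0`, some power of two lies between `m` and `2 * m`, hence the doubled argument of `u`.
-/
theorem domLp_iSup_le {Y : ℕ → ℕ → Ω → ℝ≥0∞} {u : ℕ → ℝ≥0∞} {K : ℝ≥0∞} (hp : 1 ≤ p)
    (hsub : ∀ a b c ω, a ≤ b → b ≤ c → Y a c ω ≤ Y a b ω + Y b c ω) (h0 : ∀ a ω, Y a a ω = 0)
    (hu : ∀ a b, a ≤ b → DomLp P p (Y a b) (u (b - a))) (humono : Monotone u) (hK1 : 1 ≤ K)
    (hK : ∀ m, u m + 2 ^ (1 / p) * (K * u m) ≤ K * u (2 * m)) (a m : ℕ) :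
    DomLp P p (fun ω => ⨆ (k : ℕ) (_ : k ≤ m), Y a (a + k) ω) (K * u (2 * m)) := by
  rcases Nat.eq_zero_or_pos m with rfl | hm
  · refine DomLp.zero (by linarith) fun ω => ?_
    simp [h0]
  · refine (domLp_iSup_le_two_pow hp hsub h0 hu hK1 hK (Nat.log 2 m + 1) a).mono
      (fun ω => iSup₂_le fun k hk => le_iSup₂_of_le k (hk.trans ?_) le_rfl) ?_
    · exact (Nat.lt_pow_succ_log_self one_lt_two m).le
    · gcongr
      apply humono
      have := Nat.pow_log_le_self 2 hm.ne'
      rw [pow_succ]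
      omega

end Maximal

/-! ### The growth function `A m^{1/2} + B m^{1/2-κ}` -/

section Growth

/-- The growth function `A m^{1/2} + B m^{1/2-κ}`. -/
noncomputable def growth (κ A B : ℝ) (m : ℕ) : ℝ :=
  A * (m : ℝ) ^ (1 / 2 : ℝ) + B * (m : ℝ) ^ (1 / 2 - κ)

variable {κ A B : ℝ}

theorem growth_nonneg (hA : 0 ≤ A) (hB : 0 ≤ B) (m : ℕ) : 0 ≤ growth κ A B m := by
  unfold growth; positivity

theorem growth_zero (hκ' : κ < 1 / 2) : growth κ A B 0 = 0 := by
  have h : (1 / 2 - κ) ≠ 0 := by linarith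
  simp only [growth, Nat.cast_zero, Real.zero_rpow h]
  simp

theorem growth_mono (hκ' : κ < 1 / 2) (hA : 0 ≤ A) (hB : 0 ≤ B) : Monotone (growth κ A B) := by
  intro m m' h
  have h' : (m : ℝ) ≤ m' := by exact_mod_cast h
  have : 0 ≤ 1 / 2 - κ := by linarith
  unfold growth
  gcongr

/-- Doubling multiplies the two terms by `2^(1/2)` and `2^(1/2-κ)`, and the smaller factor serves
for both. This is the gain that must beat `2^(1/ν)`. -/
theorem le_growth_two_mul (hκ : 0 < κ) (hA : 0 ≤ A) (m : ℕ) :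
    (2 : ℝ) ^ (1 / 2 - κ) * growth κ A B m ≤ growth κ A B (2 * m) := by
  have h2 : (2 : ℝ) ^ (1 / 2 - κ) ≤ 2 ^ (1 / 2 : ℝ) :=
    Real.rpow_le_rpow_of_exponent_le one_le_two (by linarith)
  unfold growth
  push_cast
  rw [Real.mul_rpow zero_le_two (by positivity), Real.mul_rpow zero_le_two (by positivity)]
  have : (0 : ℝ) ≤ A * (m : ℝ) ^ (1 / 2 : ℝ) := by positivity
  nlinarith [mul_le_mul_of_nonneg_right h2 this]

theorem growth_two_mul_le (hκ : 0 < κ) (hA : 0 ≤ A) (hB : 0 ≤ B) (m : ℕ) :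
    growth κ A B (2 * m) ≤ 2 * growth κ A B m := by
  have h1 : (2 : ℝ) ^ (1 / 2 - κ) ≤ 2 := by
    simpa using Real.rpow_le_rpow_of_exponent_le one_le_two (by linarith : 1 / 2 - κ ≤ 1)
  have h2 : (2 : ℝ) ^ (1 / 2 : ℝ) ≤ 2 := by
    simpa using Real.rpow_le_rpow_of_exponent_le one_le_two (by norm_num : (1 / 2 : ℝ) ≤ 1)
  unfold growth
  push_cast
  rw [Real.mul_rpow zero_le_two (by positivity), Real.mul_rpow zero_le_two (by positivity)]
  have h3 : (0 : ℝ) ≤ A * (m : ℝ) ^ (1 / 2 : ℝ) := by positivity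
  have h4 : (0 : ℝ) ≤ B * (m : ℝ) ^ (1 / 2 - κ) := by positivity
  nlinarith [mul_le_mul_of_nonneg_right h2 h3, mul_le_mul_of_nonneg_right h1 h4]

theorem growth_eq_sqrt_mul (hκ' : κ < 1 / 2) (m : ℕ) :
    growth κ A B m = √(m : ℝ) * (A + B * (m : ℝ) ^ (-κ)) := by
  rcases Nat.eq_zero_or_pos m with rfl | hm
  · simp [growth_zero hκ']
  · have hm' : (0 : ℝ) < m := by exact_mod_cast hm
    unfold growth
    rw [Real.sqrt_eq_rpow, sub_eq_add_neg, Real.rpow_add hm']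
    ring

theorem growth_le_mul_sqrt (hκ : 0 < κ) (hκ' : κ < 1 / 2) (hB : 0 ≤ B) (m : ℕ) :
    growth κ A B m ≤ (A + B) * √(m : ℝ) := by
  rcases Nat.eq_zero_or_pos m with rfl | hm
  · simp [growth_zero hκ']
  · have hm' : (1 : ℝ) ≤ m := by exact_mod_cast hm
    rw [growth_eq_sqrt_mul hκ', mul_comm]
    gcongr
    exact mul_le_of_le_one_right hB (Real.rpow_le_one_of_one_le_of_nonpos hm' (by linarith))

/-- Turns `γ^(ν/2)` into the `ν`-th power of a growth function, so that the hypothesis on moments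
reads as an `L^ν` bound. -/
theorem gammaBound_eq_growth_sq {C : ℝ} (hC : 0 ≤ C) (hκ' : κ < 1 / 2) (R J : ℝ → ℝ) (m : ℕ)
    (δ : ℝ) : gammaBound C κ R J m δ = growth κ (√C * R δ) (√C * J δ) m ^ 2 := by
  rw [growth_eq_sqrt_mul hκ', gammaBound, mul_pow, Real.sq_sqrt (by positivity),
    show √C * R δ + √C * J δ * (m : ℝ) ^ (-κ) = √C * (R δ + J δ * (m : ℝ) ^ (-κ)) by ring,
    mul_pow, Real.sq_sqrt hC]
  ring

/-- Concavity of `x ↦ x^a` at the midpoint of `x` and `y`. -/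
theorem rpow_add_rpow_le_of_add_eq {a x y z : ℝ} (hx : 0 ≤ x) (hy : 0 ≤ y) (hz : x + y = z)
    (ha : 0 ≤ a) (ha1 : a ≤ 1) : x ^ a + y ^ a ≤ 2 ^ (1 - a) * z ^ a := by
  have h := (Real.concaveOn_rpow ha ha1).2 (mem_Ici.2 hx) (mem_Ici.2 hy)
    (by norm_num : (0 : ℝ) ≤ 1 / 2) (by norm_num : (0 : ℝ) ≤ 1 / 2) (by norm_num)
  simp only [smul_eq_mul] at h
  have h2 : (2 : ℝ) ^ (1 - a) = 2 * (1 / 2) ^ a := by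
    rw [Real.rpow_sub two_pos, Real.rpow_one, one_div, Real.inv_rpow zero_le_two]; rfl
  rw [h2, ← hz, mul_assoc, ← Real.mul_rpow (by norm_num) (by linarith), mul_add]
  linarith

/-- The square is a nonnegative combination of the powers `m^1`, `m^(1-κ)`, `m^(1-2κ)`, and each
exponent `a ≥ 1 - 2κ` costs a factor `2^(1-a) ≤ 2^(2κ)`. The index is admissible because `2κ < 1 -
2/ν`, and it depends on neither `A` nor `B`, hence not on `δ`. -/
theorem conditionS_growth_sq {ν : ℝ} (hν : 2 < ν) (hκ : 0 < κ) (hκν : κ < 1 / 2 - 1 / ν)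
    (hA : 0 ≤ A) (hB : 0 ≤ B) :
    ConditionS (ν / 2) (fun m => growth κ A B m ^ 2) ((2 : ℝ) ^ (2 * κ)) := by
  have hν' : 0 < 1 / ν := by positivity
  have hκ' : κ < 1 / 2 := by linarith
  refine ⟨Real.one_le_rpow one_le_two (by linarith), ?_, fun m _ => sq_nonneg _, ?_, ?_⟩
  · apply Real.rpow_lt_rpow_of_exponent_lt one_lt_two
    have : (ν / 2 - 1) / (ν / 2) = 1 - 2 * (1 / ν) := by field_simp
    rw [this]; linarith
  · intro m m' _ h
    exact pow_le_pow_left₀ (growth_nonneg hA hB m) (growth_mono hκ' hA hB h) 2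
  · intro i j hi hij
    have expand : ∀ m : ℕ, 1 ≤ m → growth κ A B m ^ 2 = A ^ 2 * (m : ℝ) ^ (1 : ℝ) +
        2 * A * B * (m : ℝ) ^ (1 - κ) + B ^ 2 * (m : ℝ) ^ (1 - 2 * κ) := by
      intro m hm
      have hm' : (0 : ℝ) < m := by exact_mod_cast hm
      have e1 : (m : ℝ) ^ (1 : ℝ) = (m : ℝ) ^ (1 / 2 : ℝ) * (m : ℝ) ^ (1 / 2 : ℝ) := by
        rw [← Real.rpow_add hm']; norm_num
      have e2 : (m : ℝ) ^ (1 - κ) = (m : ℝ) ^ (1 / 2 : ℝ) * (m : ℝ) ^ (1 / 2 - κ) := by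
        rw [← Real.rpow_add hm']; congr 1; ring
      have e3 : (m : ℝ) ^ (1 - 2 * κ) = (m : ℝ) ^ (1 / 2 - κ) * (m : ℝ) ^ (1 / 2 - κ) := by
        rw [← Real.rpow_add hm']; congr 1; ring
      rw [e1, e2, e3, growth]
      ring
    have term : ∀ a : ℝ, 1 - 2 * κ ≤ a → a ≤ 1 →
        (i : ℝ) ^ a + ((j - i : ℕ) : ℝ) ^ a ≤ 2 ^ (2 * κ) * (j : ℝ) ^ a := by
      intro a h1 h2
      refine (rpow_add_rpow_le_of_add_eq (by positivity) (by positivity) (z := j) ?_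
        (by linarith) h2).trans ?_
      · rw [Nat.cast_sub hij.le]; ring
      · gcongr
        · exact one_le_two
        · linarith
    rw [expand i hi, expand (j - i) (by omega), expand j (by omega)]
    have t1 := mul_le_mul_of_nonneg_left (term 1 (by linarith) le_rfl) (sq_nonneg A)
    have t2 := mul_le_mul_of_nonneg_left (term (1 - κ) (by linarith) (by linarith))
      (by positivity : 0 ≤ 2 * A * B)
    have t3 := mul_le_mul_of_nonneg_left (term (1 - 2 * κ) le_rfl (by linarith)) (sq_nonneg B)
    linarith

variable {Ω : Type*} [MeasurableSpace Ω] (P : Measure Ω)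

theorem exists_domLp_iSup_le_growth {ν : ℝ} (hν : 2 < ν) (hκ : 0 < κ) (hκν : κ < 1 / 2 - 1 / ν) :
    ∃ K : ℝ, 0 ≤ K ∧ ∀ A B : ℝ, 0 ≤ A → 0 ≤ B → ∀ Y : ℕ → ℕ → Ω → ℝ≥0∞,
      (∀ a b c ω, a ≤ b → b ≤ c → Y a c ω ≤ Y a b ω + Y b c ω) → (∀ a ω, Y a a ω = 0) →
      (∀ a b, a ≤ b → DomLp P ν (Y a b) (ENNReal.ofReal (growth κ A B (b - a)))) →
      ∀ a m, DomLp P ν (fun ω => ⨆ (k : ℕ) (_ : k ≤ m), Y a (a + k) ω)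
        (ENNReal.ofReal (K * growth κ A B m)) := by
  have hν' : 0 < 1 / ν := by positivity
  have hκ' : κ < 1 / 2 := by linarith
  have hgap : (2 : ℝ) ^ (1 / ν) < 2 ^ (1 / 2 - κ) :=
    Real.rpow_lt_rpow_of_exponent_lt one_lt_two (by linarith)
  -- Solves `1 + 2^(1/ν) K ≤ 2^(1/2-κ) K`, which closes the halving recursion. `K` depends only on
  -- `ν` and `κ`, so the same constant works for every `δ`.
  set K : ℝ := max 1 (1 / ((2 : ℝ) ^ (1 / 2 - κ) - 2 ^ (1 / ν)))
  have hK1 : 1 ≤ K := le_max_left _ _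
  have hK2 : 1 ≤ K * ((2 : ℝ) ^ (1 / 2 - κ) - 2 ^ (1 / ν)) := by
    have : 1 / ((2 : ℝ) ^ (1 / 2 - κ) - 2 ^ (1 / ν)) ≤ K := le_max_right _ _
    rwa [div_le_iff₀ (by linarith)] at this
  have hK0 : 0 ≤ K := by linarith
  -- The extra factor `2` undoes the doubled argument, by `growth_two_mul_le`.
  refine ⟨K * 2, by positivity, fun A B hA hB Y hsub h0 hu a m => ?_⟩
  have hg := growth_nonneg (κ := κ) hA hB
  refine (domLp_iSup_le (K := ENNReal.ofReal K)
    (u := fun m => ENNReal.ofReal (growth κ A B m)) (by linarith) hsub h0 hu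
    (fun m m' h => ENNReal.ofReal_le_ofReal (growth_mono hκ' hA hB h)) (by simpa) ?_ a m).mono
    (fun _ => le_rfl) ?_
  · intro m
    have h2 : (2 : ℝ≥0∞) ^ (1 / ν) = ENNReal.ofReal ((2 : ℝ) ^ (1 / ν)) := by
      rw [← ENNReal.ofReal_rpow_of_nonneg zero_le_two hν'.le]; simp
    rw [h2, ← ENNReal.ofReal_mul hK0, ← ENNReal.ofReal_mul (by positivity),
      ← ENNReal.ofReal_mul hK0, ← ENNReal.ofReal_add (hg m)
      (mul_nonneg (by positivity) (mul_nonneg hK0 (hg m)))]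
    apply ENNReal.ofReal_le_ofReal
    have h3 := mul_le_mul_of_nonneg_left (le_growth_two_mul (B := B) hκ hA m) hK0
    have h4 := mul_le_mul_of_nonneg_right hK2 (hg m)
    linarith
  · rw [← ENNReal.ofReal_mul hK0]
    apply ENNReal.ofReal_le_ofReal
    have := mul_le_mul_of_nonneg_left (growth_two_mul_le hκ hA hB m) hK0
    linarith

end Growth

section Application

variable {Ω 𝒳 : Type*} [MeasurableSpace Ω]
  {P : Measure Ω} {X : ℕ → ℕ → Ω → 𝒳}

/-! ### Algebra of partial sums -/

theorem partialSum_add_partialSum {n a b c : ℕ} (hab : a ≤ b) (hbc : b ≤ c) (f : 𝒳 → ℝ) (ω : Ω) :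
    partialSum P X n (a + 1) b f ω + partialSum P X n (b + 1) c f ω =
      partialSum P X n (a + 1) c f ω := by
  simp only [partialSum, Finset.Icc_add_one_left_eq_Ioc]
  exact Finset.sum_Ioc_consecutive _ hab hbc

theorem partialSum_of_lt {n i j : ℕ} (h : j < i) (f : 𝒳 → ℝ) (ω : Ω) :
    partialSum P X n i j f ω = 0 := by
  simp [partialSum, Finset.Icc_eq_empty_of_lt h]

theorem measurable_partialSum [MeasurableSpace 𝒳] (hX : ∀ n i, 1 ≤ i → i ≤ n → Measurable (X n i)) {f : 𝒳 → ℝ}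
    (hf : Measurable f) {n i j : ℕ} (hi : 1 ≤ i) (hj : j ≤ n) :
    Measurable (partialSum P X n i j f) := by
  refine Finset.measurable_fun_sum _ fun k hk => ?_
  rw [Finset.mem_Icc] at hk
  exact (hf.comp (hX n k (by omega) (by omega))).sub_const _

theorem IsEnvelope.integrable_comp [MeasurableSpace 𝒳] {F : Set (𝒳 → ℝ)} {Fenv : 𝒳 → ℝ} (hF : IsEnvelope P X F Fenv)
    (hX : ∀ n i, 1 ≤ i → i ≤ n → Measurable (X n i)) {f : 𝒳 → ℝ} (hf : f ∈ F)
    (hfm : Measurable f) {n i : ℕ} (h1 : 1 ≤ i) (hi : i ≤ n) :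
    Integrable (fun ω => f (X n i ω)) P :=
  (hF.integrable n i h1 hi).mono' (hfm.comp (hX n i h1 hi)).aestronglyMeasurable
    (Eventually.of_forall fun ω => hF.bound f hf (X n i ω))

theorem partialSum_sub [MeasurableSpace 𝒳] {F : Set (𝒳 → ℝ)} {Fenv : 𝒳 → ℝ} (hF : IsEnvelope P X F Fenv)
    (hX : ∀ n i, 1 ≤ i → i ≤ n → Measurable (X n i)) (hFmeas : ∀ f ∈ F, Measurable f)
    {f g : 𝒳 → ℝ} (hf : f ∈ F) (hg : g ∈ F) {n i j : ℕ} (hi : 1 ≤ i) (hj : j ≤ n) (ω : Ω) :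
    partialSum P X n i j (fun x => f x - g x) ω =
      partialSum P X n i j f ω - partialSum P X n i j g ω := by
  unfold partialSum
  rw [← Finset.sum_sub_distrib]
  refine Finset.sum_congr rfl fun k hk => ?_
  rw [Finset.mem_Icc] at hk
  rw [integral_sub (hF.integrable_comp hX hf (hFmeas f hf) (by omega) (by omega))
    (hF.integrable_comp hX hg (hFmeas g hg) (by omega) (by omega))]
  ring

theorem ofReal_abs_add_le (x y : ℝ) :
    ENNReal.ofReal |x + y| ≤ ENNReal.ofReal |x| + ENNReal.ofReal |y| := by
  rw [← ENNReal.ofReal_add (abs_nonneg _) (abs_nonneg _)]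
  exact ENNReal.ofReal_le_ofReal (abs_add_le x y)

theorem ofReal_abs_sub_le (x y : ℝ) :
    ENNReal.ofReal |x - y| ≤ ENNReal.ofReal |x| + ENNReal.ofReal |y| := by
  simpa [sub_eq_add_neg] using ofReal_abs_add_le x (-y)

/-! ### The maximal inequality for the suprema of partial sums -/

theorem le_supSum {H : Set (𝒳 → ℝ)} {f : 𝒳 → ℝ} (hf : f ∈ H) (n i j : ℕ) (ω : Ω) :
    ENNReal.ofReal |partialSum P X n i j f ω| ≤ supSum P X H n i j ω :=
  le_iSup₂_of_le f hf le_rfl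

theorem supSum_of_lt {H : Set (𝒳 → ℝ)} {n i j : ℕ} (h : j < i) (ω : Ω) :
    supSum P X H n i j ω = 0 := by
  simp [supSum, partialSum_of_lt h]

theorem supSum_le_add {H : Set (𝒳 → ℝ)} {n a b c : ℕ} (hab : a ≤ b) (hbc : b ≤ c) (ω : Ω) :
    supSum P X H n (a + 1) c ω ≤ supSum P X H n (a + 1) b ω + supSum P X H n (b + 1) c ω := by
  refine iSup₂_le fun f hf => ?_
  rw [← partialSum_add_partialSum hab hbc]
  exact (ofReal_abs_add_le _ _).trans (add_le_add (le_supSum hf _ _ _ _) (le_supSum hf _ _ _ _))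

/-- The outer moments of the suprema over `H` of the partial sums of the `n`-th row are bounded by
a growth function of the number of summands. -/
def SupBound (P : Measure Ω) (X : ℕ → ℕ → Ω → 𝒳) (H : Set (𝒳 → ℝ)) (ν κ A B : ℝ) (n : ℕ) : Prop :=
  ∀ i j, 1 ≤ i → i ≤ j → j ≤ n →
    DomLp P ν (supSum P X H n i j) (ENNReal.ofReal (growth κ A B (j - i + 1)))

theorem exists_domLp_iSup_supSum_le (P : Measure Ω) (X : ℕ → ℕ → Ω → 𝒳) {ν κ : ℝ} (hν : 2 < ν)
    (hκ : 0 < κ) (hκν : κ < 1 / 2 - 1 / ν) :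
    ∃ K : ℝ, 0 ≤ K ∧ ∀ (A B : ℝ), 0 ≤ A → 0 ≤ B → ∀ (H : Set (𝒳 → ℝ)) (n : ℕ),
      SupBound P X H ν κ A B n → ∀ a m,
      DomLp P ν (fun ω => ⨆ (k : ℕ) (_ : k ≤ m), supSum P X H n (a + 1) (min (a + k) n) ω)
        (ENNReal.ofReal (K * growth κ A B m)) := by
  obtain ⟨K, hK, h⟩ := exists_domLp_iSup_le_growth P hν hκ hκν
  have hκ' : κ < 1 / 2 := by
    have : 0 < 1 / ν := by positivity
    linarith
  refine ⟨K, hK, fun A B hA hB H n hH a m => ?_⟩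
  -- Truncating at `n` extends the row to all indices: nothing is assumed about `X n k` for `k > n`,
  -- and intervals beyond `n` become empty.
  refine h A B hA hB (fun a b ω => supSum P X H n (a + 1) (min b n) ω) ?_ ?_ ?_ a m
  · intro a b c ω hab hbc
    rcases le_or_gt n a with hna | hna
    · rw [supSum_of_lt (by omega)]
      exact zero_le
    rcases le_or_gt b n with hbn | hbn
    · rw [min_eq_left hbn]
      exact supSum_le_add hab (by omega) ω
    · rw [min_eq_right hbn.le, min_eq_right (by omega : n ≤ c)]
      exact le_self_add
  · intro a ω
    exact supSum_of_lt (by omega) ω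
  · intro a b hab
    rcases le_or_gt (a + 1) (min b n) with hlt | hlt
    · refine (hH (a + 1) (min b n) (by omega) hlt (min_le_right _ _)).mono (fun _ => le_rfl) ?_
      exact ENNReal.ofReal_le_ofReal (growth_mono hκ' hA hB (by omega))
    · exact DomLp.zero (by linarith) fun ω => supSum_of_lt hlt ω

/-! ### Asymptotic equicontinuity of the sequential empirical process -/

/-- Both `a` and `b` lie within `2 * m` of the left end of the length-`m` block containing `a`. The
increment is thus a difference of two sums started there, which gives the factor `2` and a maximum
over block starts only. -/
theorem ofReal_abs_partialSum_sub_le {F : Set (𝒳 → ℝ)} {f : 𝒳 → ℝ} (hf : f ∈ F) {n m a b : ℕ}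
    (hm : 0 < m) (hab : a ≤ b) (hbm : b ≤ a + m) (hbn : b ≤ n) (ω : Ω) :
    ENNReal.ofReal |partialSum P X n 1 b f ω - partialSum P X n 1 a f ω| ≤
      2 * ⨆ q ∈ Finset.range (n / m + 1), ⨆ (k : ℕ) (_ : k ≤ 2 * m),
        supSum P X F n (q * m + 1) (min (q * m + k) n) ω := by
  have hqa : a / m * m ≤ a := Nat.div_mul_le_self a m
  have haq : a < a / m * m + m := Nat.lt_div_mul_add hm
  set M := ⨆ q ∈ Finset.range (n / m + 1), ⨆ (k : ℕ) (_ : k ≤ 2 * m),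
        supSum P X F n (q * m + 1) (min (q * m + k) n) ω with hM
  have key : ∀ c, a / m * m ≤ c → c ≤ a / m * m + 2 * m → c ≤ n →
      ENNReal.ofReal |partialSum P X n (a / m * m + 1) c f ω| ≤ M := by
    intro c h1 h2 h3
    have hq : a / m ∈ Finset.range (n / m + 1) := by
      rw [Finset.mem_range, Nat.lt_succ_iff]
      exact Nat.div_le_div_right (hab.trans hbn)
    refine le_trans ?_ (le_iSup₂_of_le (a / m) hq
      (le_iSup₂_of_le (c - a / m * m) (by omega) le_rfl))
    rw [Nat.add_sub_cancel' h1, min_eq_left h3]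
    exact le_supSum hf _ _ _ _
  have e1 := partialSum_add_partialSum (P := P) (X := X) (n := n) (Nat.zero_le _)
    (hqa.trans hab) f ω
  have e2 := partialSum_add_partialSum (P := P) (X := X) (n := n) (Nat.zero_le _) hqa f ω
  rw [zero_add] at e1 e2
  rw [← e1, ← e2, add_sub_add_left_eq_sub, two_mul]
  exact (ofReal_abs_sub_le _ _).trans
    (add_le_add (key b (by omega) (by omega) hbn) (key a hqa (by omega) (by omega)))

theorem floor_mul_le (n : ℕ) (t : Icc (0 : ℝ) 1) : ⌊(n : ℝ) * t.1⌋₊ ≤ n :=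
  Nat.floor_le_of_le (mul_le_of_le_one_right (Nat.cast_nonneg n) t.2.2)

theorem floor_mul_le_floor_mul_add {n : ℕ} {s t δ : ℝ} (h : |s - t| ≤ δ) : ⌊(n : ℝ) * t⌋₊ ≤ ⌊(n : ℝ) * s⌋₊ + (⌊(n : ℝ) * δ⌋₊ + 1) := by
  have h1 := Nat.lt_floor_add_one ((n : ℝ) * s)
  have h2 := Nat.lt_floor_add_one ((n : ℝ) * δ)
  rw [← Nat.lt_succ_iff]
  refine (Nat.floor_lt' (by omega)).2 ?_
  push_cast
  have : (n : ℝ) * t ≤ n * s + n * δ := by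
    rw [← mul_add]
    gcongr
    linarith [(abs_le.1 h).1]
  linarith

theorem ofReal_abs_seqProcess_sub_le [MeasurableSpace 𝒳] {F : Set (𝒳 → ℝ)} {Fenv : 𝒳 → ℝ}
    (hF : IsEnvelope P X F Fenv) (hX : ∀ n i, 1 ≤ i → i ≤ n → Measurable (X n i))
    (hFmeas : ∀ f ∈ F, Measurable f) {ρ : F → F → ℝ} (hρ : IsSemimetric ρ) {δ : ℝ}
    (n : ℕ) (ω : Ω) {p q : Icc (0 : ℝ) 1 × F} (hpq : productSemimetric ρ p q ≤ δ) :
    ENNReal.ofReal |(seqProcess P X F n ω p) - (seqProcess P X F n ω q)| ≤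
      ENNReal.ofReal (1 / √(n : ℝ)) *
        ((⨆ (k : ℕ) (_ : k ≤ n),
            supSum P X (differenceClass F ρ δ) n (0 + 1) (min (0 + k) n) ω) +
          2 * ⨆ r ∈ Finset.range (n / (⌊(n : ℝ) * δ⌋₊ + 1) + 1),
            ⨆ (k : ℕ) (_ : k ≤ 2 * (⌊(n : ℝ) * δ⌋₊ + 1)),
            supSum P X F n (r * (⌊(n : ℝ) * δ⌋₊ + 1) + 1)
              (min (r * (⌊(n : ℝ) * δ⌋₊ + 1) + k) n) ω) := by
  obtain ⟨s, f⟩ := p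
  obtain ⟨t, g⟩ := q
  have hst : |s.1 - t.1| ≤ δ := le_trans (le_add_of_nonneg_right (hρ.nonneg f g)) hpq
  have hfg : ρ f g ≤ δ := le_trans (le_add_of_nonneg_left (abs_nonneg _)) hpq
  unfold seqProcess
  rw [← mul_sub, abs_mul, abs_of_nonneg (by positivity), ENNReal.ofReal_mul (by positivity)]
  dsimp only
  gcongr
  -- Intermediate point `(s, g)`: first the function changes at fixed time, then the time changes
  -- for fixed `g`.
  rw [← sub_add_sub_cancel _ (partialSum P X n 1 ⌊(n : ℝ) * s.1⌋₊ g.1 ω) _]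
  refine (ofReal_abs_add_le _ _).trans (add_le_add ?_ ?_)
  · have hmem : (fun x => f.1 x - g.1 x) ∈ differenceClass F ρ δ := ⟨f, g, hfg, rfl⟩
    have hs := floor_mul_le n s
    rw [← partialSum_sub hF hX hFmeas f.2 g.2 le_rfl hs]
    refine le_iSup₂_of_le ⌊(n : ℝ) * s.1⌋₊ hs ?_
    rw [zero_add, zero_add, min_eq_left hs]
    exact le_supSum hmem _ _ _ _
  · rcases le_total ⌊(n : ℝ) * s.1⌋₊ ⌊(n : ℝ) * t.1⌋₊ with h | h
    · rw [abs_sub_comm]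
      exact ofReal_abs_partialSum_sub_le g.2 (Nat.succ_pos _) h
        (floor_mul_le_floor_mul_add hst) (floor_mul_le n t) ω
    · exact ofReal_abs_partialSum_sub_le g.2 (Nat.succ_pos _) h
        (floor_mul_le_floor_mul_add (by rwa [abs_sub_comm])) (floor_mul_le n s) ω

/-- The number of blocks is at most `2/δ`, costing `δ^(-1/ν)`. A window of order `nδ` contributes
`√(nδ)`, which after normalization by `√n` is of order `δ^(1/2)`. -/
theorem card_rpow_mul_growth_le {ν κ A B K δ : ℝ} (hν : 2 < ν) (hκ : 0 < κ) (hκ' : κ < 1 / 2)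
    (hA : 0 ≤ A) (hB : 0 ≤ B) (hK : 0 ≤ K) (hδ : 0 < δ) (hδ1 : δ ≤ 1) {n : ℕ}
    (hn : 1 / δ ≤ n) :
    1 / √(n : ℝ) * (((n / (⌊(n : ℝ) * δ⌋₊ + 1) + 1 : ℕ) : ℝ) ^ (1 / ν) *
        (K * growth κ A B (2 * (⌊(n : ℝ) * δ⌋₊ + 1)))) ≤
      4 * K * (A + B) * δ ^ (1 / 2 - 1 / ν) := by
  have hν0 : 0 < 1 / ν := by positivity
  have hν1 : 1 / ν ≤ 1 := by rw [div_le_one (by linarith)]; linarith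
  have hn0 : (0 : ℝ) < n := lt_of_lt_of_le (by positivity : 0 < 1 / δ) hn
  have hnδ : 1 ≤ (n : ℝ) * δ := by rwa [div_le_iff₀ hδ] at hn
  set m := ⌊(n : ℝ) * δ⌋₊ + 1 with hm
  have hm1 : (n : ℝ) * δ ≤ m := by rw [hm]; push_cast; exact (Nat.lt_floor_add_one _).le
  -- Here `1/δ ≤ n` absorbs the extra `1` in the block length.
  have hm2 : (m : ℝ) ≤ 2 * (n * δ) := by
    rw [hm]; push_cast; linarith [Nat.floor_le (by positivity : 0 ≤ (n : ℝ) * δ)]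
  have hcard : ((n / m + 1 : ℕ) : ℝ) ^ (1 / ν) ≤ 2 * δ ^ (-(1 / ν)) := by
    have h1 : ((n / m + 1 : ℕ) : ℝ) ≤ 2 * δ⁻¹ := by
      push_cast
      have h2 : ((n / m : ℕ) : ℝ) ≤ δ⁻¹ := by
        refine Nat.cast_div_le.trans ?_
        rw [div_le_iff₀ (by rw [hm]; positivity)]
        calc (n : ℝ) = δ⁻¹ * (n * δ) := by field_simp
          _ ≤ δ⁻¹ * m := by gcongr
      have h3 : 1 ≤ δ⁻¹ := (one_le_inv₀ hδ).2 hδ1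
      linarith
    calc ((n / m + 1 : ℕ) : ℝ) ^ (1 / ν) ≤ (2 * δ⁻¹) ^ (1 / ν) := by gcongr
      _ = 2 ^ (1 / ν) * δ ^ (-(1 / ν)) := by
        rw [Real.mul_rpow zero_le_two (by positivity), Real.inv_rpow hδ.le, Real.rpow_neg hδ.le]
      _ ≤ 2 * δ ^ (-(1 / ν)) := by
        gcongr
        simpa using Real.rpow_le_rpow_of_exponent_le one_le_two hν1
  have hgr : 1 / √(n : ℝ) * growth κ A B (2 * m) ≤ (A + B) * (2 * δ ^ (1 / 2 : ℝ)) := by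
    have h1 := growth_le_mul_sqrt (A := A) hκ hκ' hB (2 * m)
    have h2 : √((2 * m : ℕ) : ℝ) ≤ √(n : ℝ) * (2 * δ ^ (1 / 2 : ℝ)) := by
      rw [← Real.sqrt_eq_rpow]
      refine Real.sqrt_le_iff.2 ⟨by positivity, ?_⟩
      rw [mul_pow, mul_pow, Real.sq_sqrt hn0.le, Real.sq_sqrt hδ.le]
      push_cast
      linarith
    rw [one_div, inv_mul_le_iff₀ (by positivity)]
    refine h1.trans ?_
    calc (A + B) * √((2 * m : ℕ) : ℝ) ≤ (A + B) * (√(n : ℝ) * (2 * δ ^ (1 / 2 : ℝ))) := by gcongr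
      _ = _ := by ring
  calc _ = ((n / m + 1 : ℕ) : ℝ) ^ (1 / ν) * K * (1 / √(n : ℝ) * growth κ A B (2 * m)) := by ring
    _ ≤ (2 * δ ^ (-(1 / ν))) * K * ((A + B) * (2 * δ ^ (1 / 2 : ℝ))) := by
      have := growth_nonneg (κ := κ) hA hB (2 * m)
      gcongr
    _ = 4 * K * (A + B) * (δ ^ (1 / 2 : ℝ) * δ ^ (-(1 / ν))) := by ring
    _ = _ := by rw [← Real.rpow_add hδ]; rfl

/-- Markov's inequality with the `L^ν` bound `b δ n` on the modulus of continuity. The order of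
limits matters: `B δ` may blow up as `δ → 0`, but for fixed `δ` the factor `n^(-κ)` removes it,
leaving `b' δ → 0`. -/
theorem aec_seqProcess [MeasurableSpace 𝒳] {F : Set (𝒳 → ℝ)} {Fenv : 𝒳 → ℝ}
    (hF : IsEnvelope P X F Fenv) (hX : ∀ n i, 1 ≤ i → i ≤ n → Measurable (X n i))
    (hFmeas : ∀ f ∈ F, Measurable f) {ρ : F → F → ℝ} (hρ : IsSemimetric ρ) {ν κ : ℝ} (hν : 2 < ν)
    (hκ : 0 < κ) (hκν : κ < 1 / 2 - 1 / ν) {A B : ℝ → ℝ} (hA : ∀ δ, 0 < δ → 0 ≤ A δ)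
    (hB : ∀ δ, 0 < δ → 0 ≤ B δ) (hAlim : Tendsto A (𝓝[>] 0) (𝓝 0))
    (hdiff : ∀ δ, 0 < δ → ∀ n, SupBound P X (differenceClass F ρ δ) ν κ (A δ) (B δ) n)
    {A₀ B₀ : ℝ} (hA₀ : 0 ≤ A₀) (hB₀ : 0 ≤ B₀) (hall : ∀ n, SupBound P X F ν κ A₀ B₀ n) :
    AEC P (seqProcess P X F) (productSemimetric ρ) := by
  intro ε hε
  have hν0 : 0 < 1 / ν := by positivity
  have hκ' : κ < 1 / 2 := by linarith
  obtain ⟨K, hK, hmax⟩ := exists_domLp_iSup_supSum_le P X hν hκ hκν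
  set b : ℝ → ℕ → ℝ := fun δ n =>
    K * (A δ + B δ * (n : ℝ) ^ (-κ)) + 2 * (4 * K * (A₀ + B₀) * δ ^ (1 / 2 - 1 / ν)) with hb
  set b' : ℝ → ℝ := fun δ => K * A δ + 2 * (4 * K * (A₀ + B₀) * δ ^ (1 / 2 - 1 / ν)) with hb'
  have hbound : ∀ δ : ℝ, 0 < δ → δ ≤ 1 → ∀ n : ℕ, 1 / δ ≤ n →
      P {ω | (ε : EReal) < ⨆ (p : Icc (0 : ℝ) 1 × F) (q : Icc (0 : ℝ) 1 × F)
        (_ : productSemimetric ρ p q ≤ δ),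
        ((|(seqProcess P X F n ω p) - (seqProcess P X F n ω q)| : ℝ) : EReal)} ≤
        ENNReal.ofReal ((b δ n / ε) ^ ν) := by
    intro δ hδ hδ1 n hn
    have hn0 : (0 : ℝ) < n := lt_of_lt_of_le (by positivity : 0 < 1 / δ) hn
    have hAδ := hA δ hδ
    have hBδ := hB δ hδ
    have hb0 : 0 ≤ b δ n := by simp only [hb]; positivity
    have hD1 := hmax _ _ hAδ hBδ _ n (hdiff δ hδ n) 0 n
    have hD2 := DomLp.iSup_finset (by linarith)
      (Finset.range (n / (⌊(n : ℝ) * δ⌋₊ + 1) + 1)) fun r _ => hmax _ _ hA₀ hB₀ _ n (hall n)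
        (r * (⌊(n : ℝ) * δ⌋₊ + 1)) (2 * (⌊(n : ℝ) * δ⌋₊ + 1))
    have hD := (hD1.add (by linarith) (hD2.const_mul (by linarith) 2)).const_mul (by linarith)
      (ENNReal.ofReal (1 / √(n : ℝ)))
    have hD' := hD.mono (c' := ENNReal.ofReal (b δ n)) (fun _ => le_rfl) ?_
    · have := hD'.measure_lt_le (by linarith) (ε := ENNReal.ofReal ε) (by simpa)
        ENNReal.ofReal_ne_top
      rw [← ENNReal.ofReal_div_of_pos hε, ENNReal.ofReal_rpow_of_nonneg (by positivity)
        (by linarith)] at this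
      refine (measure_mono fun ω hω => ?_).trans this
      simp only [mem_ofPred_eq, lt_iSup_iff] at hω
      obtain ⟨p, q, hpq, hlt⟩ := hω
      refine lt_of_lt_of_le ?_ (ofReal_abs_seqProcess_sub_le hF hX hFmeas hρ n ω hpq)
      rw [EReal.coe_lt_coe_iff] at hlt
      exact (ENNReal.ofReal_lt_ofReal_iff (hε.trans hlt)).2 hlt
    · have h2 : (2 : ℝ≥0∞) = ENNReal.ofReal 2 := by simp
      have hg1 := growth_nonneg (κ := κ) hAδ hBδ n
      have hg2 := growth_nonneg (κ := κ) hA₀ hB₀ (2 * (⌊(n : ℝ) * δ⌋₊ + 1))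
      rw [Finset.card_range, ← ENNReal.ofReal_natCast, ENNReal.ofReal_rpow_of_nonneg
        (by positivity) hν0.le, ← ENNReal.ofReal_mul (by positivity), h2,
        ← ENNReal.ofReal_mul zero_le_two,
        ← ENNReal.ofReal_add (by positivity) (by positivity), ← ENNReal.ofReal_mul (by positivity)]
      apply ENNReal.ofReal_le_ofReal
      have h3 := card_rpow_mul_growth_le hν hκ hκ' hA₀ hB₀ hK hδ hδ1 hn
      have h4 : 1 / √(n : ℝ) * (K * growth κ (A δ) (B δ) n) = K * (A δ + B δ * (n : ℝ) ^ (-κ)) := by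
        rw [growth_eq_sqrt_mul hκ']
        field_simp
      simp only [hb]
      rw [mul_add, h4, mul_left_comm]
      linarith
  have hblim : ∀ δ, 0 < δ → Tendsto (fun n => ENNReal.ofReal ((b δ n / ε) ^ ν)) atTop
      (𝓝 (ENNReal.ofReal ((b' δ / ε) ^ ν))) := by
    intro δ hδ
    have h1 : Tendsto (fun n : ℕ => (n : ℝ) ^ (-κ)) atTop (𝓝 0) :=
      (tendsto_rpow_neg_atTop hκ).comp tendsto_natCast_atTop_atTop
    have h2 : Tendsto (fun n => b δ n) atTop (𝓝 (b' δ)) := by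
      have := (((h1.const_mul (B δ)).const_add (A δ)).const_mul K).add_const
        (2 * (4 * K * (A₀ + B₀) * δ ^ (1 / 2 - 1 / ν)))
      simpa [hb, hb'] using this
    exact (ENNReal.continuous_ofReal.tendsto _).comp
      ((h2.div_const ε).rpow_const (Or.inr (by linarith)))
  have hb'lim : Tendsto (fun δ => ENNReal.ofReal ((b' δ / ε) ^ ν)) (𝓝[>] 0) (𝓝 0) := by
    have h1 : Tendsto (fun δ : ℝ => δ ^ (1 / 2 - 1 / ν)) (𝓝[>] 0) (𝓝 0) := by
      have hpos : 0 < 1 / 2 - 1 / ν := by linarith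
      have := (Real.continuousAt_rpow_const 0 (1 / 2 - 1 / ν) (Or.inr hpos.le)).tendsto
      rw [Real.zero_rpow hpos.ne'] at this
      exact this.mono_left nhdsWithin_le_nhds
    have h2 : Tendsto b' (𝓝[>] 0) (𝓝 0) := by
      have := (hAlim.const_mul K).add ((h1.const_mul (4 * K * (A₀ + B₀))).const_mul 2)
      simpa [hb'] using this
    have h3 := (h2.div_const ε).rpow_const (p := ν) (Or.inr (by linarith))
    rw [zero_div, Real.zero_rpow (by linarith)] at h3
    have h4 := (ENNReal.continuous_ofReal.tendsto _).comp h3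
    rw [ENNReal.ofReal_zero] at h4
    exact h4
  refine tendsto_of_tendsto_of_tendsto_of_le_of_le' tendsto_const_nhds hb'lim
    (Eventually.of_forall fun _ => zero_le) ?_
  filter_upwards [Ioc_mem_nhdsGT (zero_lt_one (α := ℝ))] with δ hδ
  rw [← (hblim δ hδ.1).limsup_eq]
  refine limsup_le_limsup ?_
  filter_upwards [eventually_ge_atTop ⌈1 / δ⌉₊] with n hn
  exact hbound δ hδ.1 hδ.2 n (Nat.ceil_le.1 hn)

/-! ### Moment conditions -/

theorem exists_semimetric_bound {S : Type*} {ρ : S → S → ℝ} (hρ : IsSemimetric ρ)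
    (htb : IsTotallyBounded ρ) (x₀ : S) : ∃ Δ : ℝ, 0 < Δ ∧ ∀ x, ρ x x₀ ≤ Δ := by
  obtain ⟨t, ht⟩ := htb 1 one_pos
  have h0 : ∀ y ∈ t, 0 ≤ ρ y x₀ := fun y _ => hρ.nonneg _ _
  refine ⟨1 + ∑ y ∈ t, ρ y x₀, by linarith [Finset.sum_nonneg h0], fun x => ?_⟩
  obtain ⟨y, hy, hxy⟩ := ht x
  linarith [hρ.triangle x y x₀, Finset.single_le_sum h0 hy]

/-- Since `F` lies in a `ρ`-ball of radius `Δ` about `f₀`, every `f - f₀` belongs to `F_Δ`.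
Minkowski then adds the `D √m` bound for `f₀`, which only increases the coefficient `A`. -/
theorem supBound_all [MeasurableSpace 𝒳] {F : Set (𝒳 → ℝ)} {Fenv : 𝒳 → ℝ}
    (hF : IsEnvelope P X F Fenv) (hX : ∀ n i, 1 ≤ i → i ≤ n → Measurable (X n i))
    (hFmeas : ∀ f ∈ F, Measurable f) {ρ : F → F → ℝ} {ν κ A B Δ D : ℝ} (hν : 2 < ν) (hA : 0 ≤ A)
    (hB : 0 ≤ B) {n : ℕ} (hdiff : SupBound P X (differenceClass F ρ Δ) ν κ A B n) {f₀ : 𝒳 → ℝ}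
    (hf₀ : f₀ ∈ F) (hΔ : ∀ f, ρ f ⟨f₀, hf₀⟩ ≤ Δ) (hD : 0 ≤ D)
    (hf₀moment : ∀ i j : ℕ, 1 ≤ i → i ≤ j → j ≤ n →
      eLpNorm (partialSum P X n i j f₀) (ENNReal.ofReal ν) P ≤
        ENNReal.ofReal (D * √((j - i + 1 : ℕ) : ℝ))) :
    SupBound P X F ν κ (A + D) B n := by
  intro i j hi hij hj
  have h1 : DomLp P ν (fun ω => ENNReal.ofReal |partialSum P X n i j f₀ ω|)
      (ENNReal.ofReal (D * √((j - i + 1 : ℕ) : ℝ))) := by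
    refine ⟨_, (measurable_partialSum hX (hFmeas f₀ hf₀) hi hj).abs.ennreal_ofReal,
      fun _ => le_rfl, le_trans (le_of_eq ?_) (hf₀moment i j hi hij hj)⟩
    have hν0 : 0 < ν := by linarith
    rw [eLpNorm_eq_lintegral_rpow_enorm_toReal (by simpa) ENNReal.ofReal_ne_top,
      ENNReal.toReal_ofReal hν0.le]
    simp_rw [← Real.norm_eq_abs, ofReal_norm]
  refine ((hdiff i j hi hij hj).add (by linarith) h1).mono (fun ω => iSup₂_le fun f hf => ?_) ?_
  · have hmem : (fun x => f x - f₀ x) ∈ differenceClass F ρ Δ := ⟨⟨f, hf⟩, ⟨f₀, hf₀⟩, hΔ _, rfl⟩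
    have := partialSum_sub hF hX hFmeas hf hf₀ (n := n) (j := j) hi hj ω
    rw [← sub_add_cancel (partialSum P X n i j f ω) (partialSum P X n i j f₀ ω), ← this]
    refine (ofReal_abs_add_le _ _).trans (add_le_add_left ?_ _)
    exact le_supSum hmem _ _ _ _
  · rw [← ENNReal.ofReal_add (growth_nonneg hA hB _) (by positivity)]
    apply ENNReal.ofReal_le_ofReal
    rw [Real.sqrt_eq_rpow, growth, growth]
    linarith

/-- The function `g` is `γ` itself, with `γ(n, δ)/n → C R(δ)²`. The bound `h(m) ≤ (A₀ + B₀)² m`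
gives the last condition. -/
theorem momentConditions {F : Set (𝒳 → ℝ)} {ρ : F → F → ℝ} {ν κ C : ℝ} (hν : 2 < ν) (hκ : 0 < κ)
    (hκν : κ < 1 / 2 - 1 / ν) (hC : 0 ≤ C) {R J : ℝ → ℝ} (hR : ∀ δ, 0 < δ → 0 ≤ R δ)
    (hJ : ∀ δ, 0 < δ → 0 ≤ J δ) (hRlim : Tendsto R (𝓝[>] 0) (𝓝 0))
    (hmoment : ∀ (δ : ℝ) (n : ℕ), 0 < δ → ∀ i j, 1 ≤ i → i ≤ j → j ≤ n →
      outerSupMoment P X (differenceClass F ρ δ) ν n i j ≤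
        ((gammaBound C κ R J (j - i + 1) δ ^ (ν / 2) : ℝ) : EReal))
    {A₀ B₀ : ℝ} (hA₀ : 0 ≤ A₀) (hB₀ : 0 ≤ B₀) (hall : ∀ n, SupBound P X F ν κ A₀ B₀ n) :
    MomentConditions P X F ρ ν (gammaBound C κ R J) (fun m => growth κ A₀ B₀ m ^ 2) := by
  have hν0 : 0 < 1 / ν := by positivity
  have hκ' : κ < 1 / 2 := by linarith
  refine ⟨fun n δ hδ => hmoment δ n hδ, ⟨(2 : ℝ) ^ (2 * κ), fun δ hδ => ?_⟩, fun n i j hi hij hj => ?_,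
    ⟨_, conditionS_growth_sq hν hκ hκν hA₀ hB₀⟩, ?_, ?_, (A₀ + B₀) ^ 2, sq_nonneg _, ?_⟩
  · have hRδ := hR δ hδ
    have hJδ := hJ δ hδ
    simp_rw [gammaBound_eq_growth_sq hC hκ']
    exact conditionS_growth_sq hν hκ hκν (by positivity) (by positivity)
  · have hg := growth_nonneg (κ := κ) hA₀ hB₀ (j - i + 1)
    have := outerSupMoment_le_of_domLp_supSum (by linarith) hg (hall n i j hi hij hj)
    rwa [← Real.rpow_natCast, ← Real.rpow_mul hg, Nat.cast_ofNat, mul_div_cancel₀ _ two_ne_zero]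
  · have hlim : ∀ δ, limsup (fun n : ℕ => ((gammaBound C κ R J n δ / (n : ℝ) : ℝ) : EReal)) atTop =
        ((C * R δ ^ 2 : ℝ) : EReal) := by
      intro δ
      apply Tendsto.limsup_eq
      refine (continuous_coe_real_ereal.tendsto _).comp ?_
      have h1 : Tendsto (fun n : ℕ => (n : ℝ) ^ (-κ)) atTop (𝓝 0) :=
        (tendsto_rpow_neg_atTop hκ).comp tendsto_natCast_atTop_atTop
      have h2 := (((h1.const_mul (J δ)).const_add (R δ)).pow 2).const_mul C
      rw [mul_zero, add_zero] at h2
      refine h2.congr' ?_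
      filter_upwards [eventually_gt_atTop 0] with n hn
      have : (n : ℝ) ≠ 0 := by exact_mod_cast hn.ne'
      unfold gammaBound
      field_simp
    simp_rw [hlim]
    refine (continuous_coe_real_ereal.tendsto 0).comp ?_
    simpa using (hRlim.pow 2).const_mul C
  · simp [growth_zero hκ']
  · intro ε hε _
    refine limsup_le_of_le (by isBoundedDefault) (Eventually.of_forall fun n => ?_)
    rw [EReal.coe_le_coe_iff]
    have h1 := growth_le_mul_sqrt (A := A₀) hκ hκ' hB₀ ⌊(n : ℝ) * ε⌋₊
    have h2 := pow_le_pow_left₀ (growth_nonneg hA₀ hB₀ _) h1 2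
    rw [mul_pow, Real.sq_sqrt (by positivity)] at h2
    refine div_le_of_le_mul₀ (by positivity) (by positivity) (h2.trans ?_)
    rw [mul_assoc]
    gcongr
    rw [mul_comm]
    exact Nat.floor_le (by positivity)

end Application

/-! ### Outer expectations of bounded maps -/

section Compare

variable {Ω : Type*} [MeasurableSpace Ω] {P : Measure Ω}

theorem expectation_coe_real {f : Ω → ℝ} (hf : Integrable f P) :
    expectation P (fun ω => (f ω : EReal)) = ((∫ ω, f ω ∂P : ℝ) : EReal) := by
  have h1 : ∫⁻ ω, ENNReal.ofReal (f ω) ∂P ≠ ⊤ := by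
    have := hf.lintegral_lt_top
    exact this.ne
  have h2 : ∫⁻ ω, ENNReal.ofReal (-f ω) ∂P ≠ ⊤ := hf.neg.lintegral_lt_top.ne
  rw [integral_eq_lintegral_pos_part_sub_lintegral_neg_part hf, EReal.coe_sub,
    EReal.coe_ennreal_toReal h1, EReal.coe_ennreal_toReal h2]
  simp only [expectation, ← EReal.coe_neg, EReal.real_coe_toENNReal]

theorem hasExpectation_coe_real {f : Ω → ℝ} (hf : Integrable f P) :
    HasExpectation P (fun ω => (f ω : EReal)) :=
  Or.inl hf.lintegral_lt_top.ne

theorem expectation_mono {U V : Ω → EReal} (h : ∀ ω, U ω ≤ V ω) :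
    expectation P U ≤ expectation P V := by
  refine EReal.sub_le_sub ?_ ?_ <;> rw [EReal.coe_ennreal_le_coe_ennreal_iff]
  · exact lintegral_mono fun ω => EReal.toENNReal_le_toENNReal (h ω)
  · exact lintegral_mono fun ω => EReal.toENNReal_le_toENNReal (EReal.neg_le_neg_iff.2 (h ω))

/-- The error is `ε` plus `2M` on a measurable hull of the possibly nonmeasurable exceptional set
`B`, which has the same outer probability. -/
theorem exists_integrable_error [IsProbabilityMeasure P] {f g : Ω → ℝ} {M ε η : ℝ}
    (hf : ∀ ω, |f ω| ≤ M) (hg : ∀ ω, |g ω| ≤ M) (hε : 0 ≤ ε) (hη : 0 ≤ η) {B : Set Ω}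
    (hB : P B ≤ ENNReal.ofReal η) (h : ∀ ω ∉ B, |f ω - g ω| ≤ ε) :
    ∃ e : Ω → ℝ, Measurable e ∧ Integrable e P ∧ (∀ ω, |f ω - g ω| ≤ e ω) ∧
      ∫ ω, e ω ∂P ≤ ε + 2 * M * η := by
  have hM : ∀ _ : Ω, 0 ≤ M := fun ω => (abs_nonneg _).trans (hf ω)
  have hM : 0 ≤ M := by
    have := P.nonempty_of_neZero
    exact hM this.some
  have hmB := measurableSet_toMeasurable P B
  have hint : Integrable ((toMeasurable P B).indicator fun _ => 2 * M) P :=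
    (integrable_const _).indicator hmB
  refine ⟨fun ω => ε + (toMeasurable P B).indicator (fun _ => 2 * M) ω,
    measurable_const.add (measurable_const.indicator hmB),
    (integrable_const ε).add hint, fun ω => ?_, ?_⟩
  · by_cases hω : ω ∈ toMeasurable P B
    · simp only [indicator_of_mem hω]
      have := abs_sub (f ω) (g ω)
      linarith [hf ω, hg ω]
    · simp only [indicator_of_notMem hω, add_zero]
      exact h ω fun hωB => hω (subset_toMeasurable P B hωB)
  · rw [integral_add (integrable_const _) hint, integral_indicator_const _ hmB]
    have hle : P.real (toMeasurable P B) ≤ η := by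
      rw [measureReal_def, measure_toMeasurable]
      exact ENNReal.toReal_le_of_le_ofReal hη hB
    simp only [integral_const, probReal_univ, smul_eq_mul, one_mul]
    nlinarith

theorem abs_integral_sub_integral_le [IsProbabilityMeasure P] {f g : Ω → ℝ}
    (hfm : Measurable f) (hgm : Measurable g) {M ε η : ℝ}
    (hf : ∀ ω, |f ω| ≤ M) (hg : ∀ ω, |g ω| ≤ M) (hε : 0 ≤ ε) (hη : 0 ≤ η) {B : Set Ω}
    (hB : P B ≤ ENNReal.ofReal η) (h : ∀ ω ∉ B, |f ω - g ω| ≤ ε) :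
    |∫ ω, f ω ∂P - ∫ ω, g ω ∂P| ≤ ε + 2 * M * η := by
  obtain ⟨e, -, hei, hfe, he⟩ := exists_integrable_error hf hg hε hη hB h
  have hfi : Integrable f P :=
    .of_bound hfm.aestronglyMeasurable M (Eventually.of_forall hf)
  have hgi : Integrable g P :=
    .of_bound hgm.aestronglyMeasurable M (Eventually.of_forall hg)
  rw [← integral_sub hfi hgi]
  exact (abs_integral_le_integral_abs.trans
    (integral_mono (hfi.sub hgi).abs hei hfe)).trans he

/-- With the error `e`, `V + e` is an admissible majorant of `Y`, while every majorant of `Y`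
dominates `V - e`. -/
theorem outerExpectation_mem_Icc [IsProbabilityMeasure P] {Y V : Ω → ℝ} (hVm : Measurable V)
    {M ε η : ℝ} (hY : ∀ ω, |Y ω| ≤ M) (hV : ∀ ω, |V ω| ≤ M) (hε : 0 ≤ ε) (hη : 0 ≤ η) {B : Set Ω}
    (hB : P B ≤ ENNReal.ofReal η) (h : ∀ ω ∉ B, |Y ω - V ω| ≤ ε) :
    outerExpectation P (fun ω => (Y ω : EReal)) ∈
      Icc ((∫ ω, V ω ∂P - (ε + 2 * M * η) : ℝ) : EReal)
        ((∫ ω, V ω ∂P + (ε + 2 * M * η) : ℝ) : EReal) := by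
  obtain ⟨e, hem, hei, hfe, he⟩ := exists_integrable_error hY hV hε hη hB h
  have hVi : Integrable V P :=
    .of_bound hVm.aestronglyMeasurable M (Eventually.of_forall hV)
  constructor
  · refine le_sInf ?_
    rintro _ ⟨U, -, hYU, -, rfl⟩
    have hle : ∀ ω, ((V ω - e ω : ℝ) : EReal) ≤ U ω := fun ω =>
      le_trans (EReal.coe_le_coe_iff.2 (by linarith [(abs_le.1 (hfe ω)).1])) (hYU ω)
    refine le_trans ?_ (expectation_mono hle)
    rw [expectation_coe_real (f := fun ω => V ω - e ω) (hVi.sub hei), EReal.coe_le_coe_iff, integral_sub hVi hei]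
    linarith
  · refine (sInf_le ⟨fun ω => ((V ω + e ω : ℝ) : EReal), (hVm.add hem).coe_real_ereal, fun ω =>
      EReal.coe_le_coe_iff.2 (by linarith [(abs_le.1 (hfe ω)).2]),
      hasExpectation_coe_real (hVi.add hei), rfl⟩ : outerExpectation P _ ≤ _).trans ?_
    rw [expectation_coe_real (f := fun ω => V ω + e ω) (hVi.add hei), EReal.coe_le_coe_iff, integral_add hVi hei]
    linarith

end Compare

/-! ### Finite-dimensional projections of `ℓ^∞(T)` -/

section Projection

variable {T : Type*}

/-- The bounded function `s ↦ x (p s)`. -/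
noncomputable def compFin {I : Finset T} (p : T → I) (x : I → ℝ) : EllInfty T :=
  ⟨fun s => x (p s), memℓp_infty ⟨‖x‖, by rintro _ ⟨s, rfl⟩; exact norm_le_pi_norm x (p s)⟩⟩

/-- The restriction of a bounded function to a finite set. -/
def restrictFin (I : Finset T) (z : EllInfty T) : I → ℝ := fun t => z t

/-- The projection `z ↦ z ∘ p` with finite range. -/
noncomputable def projFin {I : Finset T} (p : T → I) (z : EllInfty T) : EllInfty T :=
  compFin p (restrictFin I z)

theorem compFin_apply {I : Finset T} (p : T → I) (x : I → ℝ) (s : T) : compFin p x s = x (p s) :=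
  rfl

theorem projFin_apply {I : Finset T} (p : T → I) (z : EllInfty T) (s : T) :
    projFin p z s = z (p s) :=
  rfl

theorem abs_apply_sub_le_norm (z w : EllInfty T) (s : T) : |z s - w s| ≤ ‖z - w‖ :=
  lp.norm_apply_le_norm (by simp) (z - w) s

theorem continuous_eval (s : T) : Continuous fun z : EllInfty T => z s := by
  refine LipschitzWith.continuous (K := 1) (LipschitzWith.of_dist_le_mul fun z w => ?_)
  rw [NNReal.coe_one, one_mul, dist_eq_norm z w]
  exact abs_apply_sub_le_norm z w s

theorem continuous_compFin {I : Finset T} (p : T → I) : Continuous (compFin p) := by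
  refine LipschitzWith.continuous (K := 1) (LipschitzWith.of_dist_le_mul fun x y => ?_)
  rw [dist_eq_norm, NNReal.coe_one, one_mul, dist_eq_norm]
  exact lp.norm_le_of_forall_le (norm_nonneg _) fun s => norm_le_pi_norm (x - y) (p s)

theorem lipschitzWith_restrictFin (I : Finset T) : LipschitzWith 1 (restrictFin I) := by
  refine LipschitzWith.of_dist_le_mul fun z w => ?_
  rw [NNReal.coe_one, one_mul, dist_eq_norm, dist_eq_norm]
  exact (pi_norm_le_iff_of_nonneg (norm_nonneg _)).2 fun t => abs_apply_sub_le_norm z w t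

theorem continuous_restrictFin (I : Finset T) : Continuous (restrictFin I) :=
  (lipschitzWith_restrictFin I).continuous

theorem continuous_projFin {I : Finset T} (p : T → I) : Continuous (projFin p) :=
  (continuous_compFin p).comp (continuous_restrictFin I)

theorem isOpen_lt_norm_sub_projFin {I : Finset T} (p : T → I) (r : ℝ) :
    IsOpen {z : EllInfty T | r < ‖z - projFin p z‖} :=
  isOpen_lt continuous_const (continuous_id.sub (continuous_projFin p)).norm

theorem exists_lt_of_lt_norm_sub {z w : EllInfty T} {r : ℝ} (hr : 0 ≤ r) (h : r < ‖z - w‖) :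
    ∃ s, r < |z s - w s| := by
  by_contra! hle
  exact absurd (lp.norm_le_of_forall_le hr fun s => hle s) (not_le.2 h)

theorem marginal_apply_restrictFin (L : Measure (EllInfty T)) (I : Finset T) {G : Set (I → ℝ)}
    (hG : MeasurableSet G) : marginal L I G = L {z | restrictFin I z ∈ G} :=
  Measure.map_apply (continuous_restrictFin I).measurable hG

theorem isProbabilityMeasure_marginal (L : Measure (EllInfty T)) [IsProbabilityMeasure L]
    (I : Finset T) : IsProbabilityMeasure (marginal L I) :=
  Measure.isProbabilityMeasure_map (continuous_restrictFin I).measurable.aemeasurable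

end Projection

/-! ### Finite-dimensional convergence -/

section Equicontinuity

variable {Ω T : Type*} [MeasurableSpace Ω] {P : Measure Ω} {Z : ℕ → Ω → EllInfty T}

theorem AEC.exists_pos_eventually {τ : T → T → ℝ} (h : AEC P (fun n ω => (Z n ω : T → ℝ)) τ)
    {r : ℝ} (hr : 0 < r) {η : ℝ≥0∞} (hη : 0 < η) :
    ∃ δ : ℝ, 0 < δ ∧
      ∀ᶠ n in atTop, P {ω | ∃ s t, τ s t ≤ δ ∧ r < |Z n ω s - Z n ω t|} ≤ η := by
  obtain ⟨δ, hδ, hδ0⟩ := (((h r hr).eventually_lt_const hη).and self_mem_nhdsWithin).exists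
  refine ⟨δ, hδ0, ?_⟩
  filter_upwards [eventually_lt_of_limsup_lt hδ] with n hn
  refine le_trans (measure_mono ?_) hn.le
  rintro ω ⟨s, t, hst, hlt⟩
  simp only [mem_ofPred_eq, lt_iSup_iff]
  exact ⟨s, t, hst, EReal.coe_lt_coe_iff.2 hlt⟩

theorem AEC.exists_projFin {τ : T → T → ℝ} (h : AEC P (fun n ω => (Z n ω : T → ℝ)) τ)
    (htb : IsTotallyBounded τ) {r : ℝ} (hr : 0 < r) {η : ℝ≥0∞} (hη : 0 < η) :
    ∃ (I : Finset T) (p : T → I), ∀ᶠ n in atTop, P {ω | r < ‖Z n ω - projFin p (Z n ω)‖} ≤ η := by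
  obtain ⟨δ, hδ, hev⟩ := h.exists_pos_eventually hr hη
  obtain ⟨I, hI⟩ := htb δ hδ
  choose p hpI hp using hI
  refine ⟨I, fun s => ⟨p s, hpI s⟩, hev.mono fun n hn => le_trans (measure_mono fun ω hω => ?_) hn⟩
  obtain ⟨s, hs⟩ := exists_lt_of_lt_norm_sub hr.le hω
  exact ⟨s, p s, (hp s).le, hs⟩

end Equicontinuity

section Fidi

variable {Ω T : Type*} [MeasurableSpace Ω] {P : Measure Ω} [IsProbabilityMeasure P]
  {Z : ℕ → Ω → EllInfty T} {μ : (I : Finset T) → Measure (I → ℝ)}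

theorem measurable_restrictFin (hZ : ∀ n t, Measurable fun ω => Z n ω t) (n : ℕ) (I : Finset T) :
    Measurable fun ω => restrictFin I (Z n ω) :=
  measurable_pi_lambda _ fun t => hZ n t

/-- The law of the restriction of `Z n` to the finite set `I`. -/
noncomputable def fidiLaw (hZ : ∀ n t, Measurable fun ω => Z n ω t) (I : Finset T) (n : ℕ) :
    ProbabilityMeasure (I → ℝ) :=
  ⟨P.map fun ω => restrictFin I (Z n ω),
    Measure.isProbabilityMeasure_map (measurable_restrictFin hZ n I).aemeasurable⟩

theorem FidiConv.tendsto_probabilityMeasure (hZ : ∀ n t, Measurable fun ω => Z n ω t)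
    (h : FidiConv P (fun n ω => (Z n ω : T → ℝ)) μ) (I : Finset T)
    [hμ : IsProbabilityMeasure (μ I)] :
    Tendsto (fidiLaw (P := P) hZ I) atTop (𝓝 (⟨μ I, hμ⟩ : ProbabilityMeasure (I → ℝ))) := by
  refine ProbabilityMeasure.tendsto_iff_forall_integral_tendsto.2 fun φ => ?_
  refine (h I φ).congr fun n => ?_
  exact (integral_map (measurable_restrictFin hZ n I).aemeasurable
    φ.continuous.aestronglyMeasurable).symm

theorem FidiConv.measure_open_le (hZ : ∀ n t, Measurable fun ω => Z n ω t)
    (h : FidiConv P (fun n ω => (Z n ω : T → ℝ)) μ) (I : Finset T) [IsProbabilityMeasure (μ I)]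
    {G : Set (I → ℝ)} (hG : IsOpen G) {η : ℝ≥0∞}
    (hη : ∀ᶠ n in atTop, P {ω | restrictFin I (Z n ω) ∈ G} ≤ η) : μ I G ≤ η := by
  have h1 := ProbabilityMeasure.le_liminf_measure_open_of_tendsto
    (h.tendsto_probabilityMeasure hZ I) hG
  refine h1.trans (liminf_le_of_frequently_le' (Eventually.frequently ?_))
  filter_upwards [hη] with n hn
  exact (Measure.map_apply (measurable_restrictFin hZ n I) hG.measurableSet).trans_le hn

theorem FidiConv.eventually_measure_closed_lt (hZ : ∀ n t, Measurable fun ω => Z n ω t)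
    (h : FidiConv P (fun n ω => (Z n ω : T → ℝ)) μ) (I : Finset T) [IsProbabilityMeasure (μ I)]
    {G : Set (I → ℝ)} (hG : IsClosed G) {η : ℝ≥0∞} (hη : μ I G < η) :
    ∀ᶠ n in atTop, P {ω | restrictFin I (Z n ω) ∈ G} < η := by
  have h1 := ProbabilityMeasure.limsup_measure_closed_le_of_tendsto
    (h.tendsto_probabilityMeasure hZ I) hG
  filter_upwards [eventually_lt_of_limsup_lt (h1.trans_lt hη)] with n hn
  exact (Measure.map_apply (measurable_restrictFin hZ n I) hG.measurableSet).symm.trans_lt hn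

/-- For finitely many `s` this is the portmanteau inequality for open sets. The index set may be
uncountable, so the union over all `s` is handled topologically: inside the open event take a closed
set, intersect it with a compact set from tightness, and extract a finite subcover. -/
theorem measure_lt_norm_sub_projFin_le (hZ : ∀ n t, Measurable fun ω => Z n ω t)
    {L : Measure (EllInfty T)} [IsProbabilityMeasure L] (hL : IsTightMeasureSet {L})
    (h : FidiConv P (fun n ω => (Z n ω : T → ℝ)) (marginal L)) {I : Finset T} {p : T → I} {r : ℝ}
    (hr : 0 ≤ r) {η : ℝ≥0∞} (hη : ∀ᶠ n in atTop, P {ω | r < ‖Z n ω - projFin p (Z n ω)‖} ≤ η) :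
    L {z | r < ‖z - projFin p z‖} ≤ η := by
  classical
  have hfin : ∀ J : Finset T, L {z | ∃ s ∈ J, r < |z s - projFin p z s|} ≤ η := by
    intro J
    have := isProbabilityMeasure_marginal L (J ∪ I)
    have hmem : ∀ s, (p s : T) ∈ J ∪ I := fun s => Finset.mem_union_right _ (p s).2
    set G : Set ((J ∪ I : Finset T) → ℝ) :=
      ⋃ s : J, {x | r < |x ⟨s, Finset.mem_union_left _ s.2⟩ - x ⟨p s, hmem s⟩|} with hGdef
    have hG : IsOpen G := isOpen_iUnion fun s => isOpen_lt continuous_const (by fun_prop)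
    have hiff : ∀ z : EllInfty T, restrictFin (J ∪ I) z ∈ G ↔
        ∃ s ∈ J, r < |z s - projFin p z s| := by
      intro z
      simp [hGdef, restrictFin, projFin_apply]
    have hle := h.measure_open_le hZ (J ∪ I) hG (η := η) <| hη.mono fun n hn => by
      refine le_trans (measure_mono fun ω hω => ?_) hn
      obtain ⟨s, -, hs⟩ := (hiff _).1 hω
      exact hs.trans_le (abs_apply_sub_le_norm _ _ s)
    rw [marginal_apply_restrictFin L _ hG.measurableSet] at hle
    simpa only [hiff] using hle
  by_contra! hlt
  obtain ⟨C, hCU, hC, hlt⟩ := (isOpen_lt_norm_sub_projFin p r).exists_lt_isClosed hlt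
  refine absurd (ENNReal.le_of_forall_pos_le_add fun ε hε _ => ?_) (not_le.2 hlt)
  obtain ⟨K, hK, hLK⟩ := isTightMeasureSet_iff_exists_isCompact_measure_compl_le.1 hL ε
    (by simpa using hε)
  obtain ⟨J, hJ⟩ := (hK.inter_left hC).elim_finite_subcover
    (fun s => {z : EllInfty T | r < |z s - projFin p z s|})
    (fun s => isOpen_lt continuous_const
      ((continuous_eval s).sub (continuous_eval (p s : T))).abs)
    (fun z hz => mem_iUnion.2 (exists_lt_of_lt_norm_sub hr (hCU hz.1)))
  calc L C ≤ L ({z | ∃ s ∈ J, r < |z s - projFin p z s|} ∪ Kᶜ) := by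
        refine measure_mono fun z hz => ?_
        by_cases hzK : z ∈ K
        · left
          simpa using hJ ⟨hz, hzK⟩
        · exact Or.inr hzK
    _ ≤ η + ε := (measure_union_le _ _).trans (add_le_add (hfin J) (hLK L rfl))

/-- `φ(Z n)` is compared with `φ` of a finite projection, whose expectation converges by hypothesis,
and the projection is then compared with the identity under `L`. A compact set carrying most of `L`
supplies the uniform continuity that `φ` may lack globally. -/
theorem weakConv_of_fidiConv {τ : T → T → ℝ} (htb : IsTotallyBounded τ)
    (hZ : ∀ n t, Measurable fun ω => Z n ω t) (haec : AEC P (fun n ω => (Z n ω : T → ℝ)) τ)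
    {L : Measure (EllInfty T)} [IsProbabilityMeasure L] (hL : IsTightMeasureSet {L})
    (h : FidiConv P (fun n ω => (Z n ω : T → ℝ)) (marginal L)) : WeakConv P Z L := by
  intro φ
  have main : ∀ ε : ℝ, 0 < ε → ∀ᶠ n in atTop,
      outerExpectation P (fun ω => ((φ (Z n ω) : ℝ) : EReal)) ∈
        Icc ((∫ z, φ z ∂L - ε : ℝ) : EReal) ((∫ z, φ z ∂L + ε : ℝ) : EReal) := by
    intro ε' hε'
    set M := ‖φ‖
    have hM : 0 ≤ M := norm_nonneg _
    have hφM : ∀ z, |φ z| ≤ M := φ.norm_coe_le_norm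
    -- Error budget: `2ε + 8Mη` for the outer expectation, `ε` for the projected integrals and `ε +
    -- 4Mη` under `L`, in all at most `ε'`.
    set ε := ε' / 8 with hεdef
    set η := ε' / (24 * (M + 1)) with hηdef
    have hε : 0 < ε := by positivity
    have hη : 0 < η := by positivity
    have hMη : 12 * (M * η) ≤ ε' / 2 := by
      have : 24 * (M + 1) * η = ε' := by rw [hηdef]; field_simp
      nlinarith
    have hη' : (0 : ℝ≥0∞) < ENNReal.ofReal η := by simpa
    obtain ⟨K, hK, hLK⟩ := isTightMeasureSet_iff_exists_isCompact_measure_compl_le.1 hL _ hη'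
    replace hLK := hLK L rfl
    obtain ⟨δ, hδ, hunif⟩ := Metric.mem_uniformity_dist.1
      (hK.uniformContinuousAt_of_continuousAt φ (fun a _ => φ.continuous.continuousAt)
        (Metric.dist_mem_uniformity hε))
    -- Only `a` has to lie in `K`; this is essential, as neither `Z n` nor its projection need lie
    -- there.
    have hunif' : ∀ a ∈ K, ∀ b, dist a b < δ → |φ a - φ b| ≤ ε := fun a ha b hab =>
      le_of_lt (hunif hab ha)
    obtain ⟨I, p, hev⟩ := haec.exists_projFin htb (by positivity : 0 < δ / 4) hη'
    have hLp := measure_lt_norm_sub_projFin_le hZ hL h (by positivity) hev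
    have := isProbabilityMeasure_marginal L I
    -- the projected process stays close to the compact set
    have hU : IsClosed {x : I → ℝ | compFin p x ∉ Metric.thickening (δ / 2) K} :=
      (Metric.isOpen_thickening.preimage (continuous_compFin p)).isClosed_compl
    have hLU : marginal L I {x : I → ℝ | compFin p x ∉ Metric.thickening (δ / 2) K} <
        ENNReal.ofReal (3 * η) := by
      rw [marginal_apply_restrictFin L I hU.measurableSet]
      refine lt_of_le_of_lt (b := ENNReal.ofReal (2 * η)) ?_
        ((ENNReal.ofReal_lt_ofReal_iff (by positivity)).2 (by linarith))
      rw [two_mul, ENNReal.ofReal_add hη.le hη.le]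
      refine le_trans (measure_mono ?_) ((measure_union_le _ _).trans (add_le_add hLK hLp))
      intro z hz
      by_contra hz'
      simp only [mem_union, mem_compl_iff, mem_ofPred_eq, not_or, not_not, not_lt] at hz'
      refine hz (Metric.mem_thickening_iff.2 ⟨z, hz'.1, ?_⟩)
      rw [dist_comm, dist_eq_norm]
      exact hz'.2.trans_lt (by linarith)
    have hev2 := h.eventually_measure_closed_lt hZ I hU hLU
    -- comparison of the integrals under the limit law
    have hLint : |∫ z, φ z ∂L - ∫ z, φ (projFin p z) ∂L| ≤ ε + 2 * M * (2 * η) := by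
      refine abs_integral_sub_integral_le (B := Kᶜ ∪ {z | δ / 4 < ‖z - projFin p z‖})
        φ.continuous.measurable (φ.continuous.comp (continuous_projFin p)).measurable hφM
        (fun z => hφM _) hε.le (by positivity) ?_ ?_
      · rw [two_mul, ENNReal.ofReal_add hη.le hη.le]
        exact (measure_union_le _ _).trans (add_le_add hLK hLp)
      · intro z hz
        simp only [mem_union, mem_compl_iff, mem_ofPred_eq, not_or, not_not, not_lt] at hz
        refine hunif' z hz.1 _ ?_
        rw [dist_eq_norm]
        exact hz.2.trans_lt (by linarith)
    -- convergence of the projected integrals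
    have hconv := h I (φ.compContinuous ⟨compFin p, continuous_compFin p⟩)
    have hmap : ∫ x, φ.compContinuous ⟨compFin p, continuous_compFin p⟩ x ∂(marginal L I) =
        ∫ z, φ (projFin p z) ∂L :=
      integral_map (continuous_restrictFin I).measurable.aemeasurable
        (BoundedContinuousFunction.continuous _).aestronglyMeasurable
    rw [hmap] at hconv
    have hev3 := Metric.tendsto_nhds.1 hconv ε hε
    filter_upwards [hev, hev2, hev3] with n h1 h2 h3
    have h3' : |∫ ω, φ (projFin p (Z n ω)) ∂P - ∫ z, φ (projFin p z) ∂L| < ε := h3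
    have hout := outerExpectation_mem_Icc (P := P) (Y := fun ω => φ (Z n ω))
      (V := fun ω => φ (projFin p (Z n ω))) (M := M) (ε := 2 * ε) (η := 4 * η)
      (B := {ω | δ / 4 < ‖Z n ω - projFin p (Z n ω)‖} ∪
        {ω | projFin p (Z n ω) ∉ Metric.thickening (δ / 2) K})
      ((φ.continuous.comp (continuous_compFin p)).measurable.comp (measurable_restrictFin hZ n I))
      (fun ω => hφM _) (fun ω => hφM _) (by positivity) (by positivity) ?_ ?_
    · have a1 := abs_lt.1 h3'
      have a2 := abs_le.1 hLint
      refine ⟨le_trans (EReal.coe_le_coe_iff.2 ?_) hout.1,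
        le_trans hout.2 (EReal.coe_le_coe_iff.2 ?_)⟩ <;> nlinarith
    · rw [show 4 * η = η + 3 * η by ring, ENNReal.ofReal_add hη.le (by positivity)]
      exact (measure_union_le _ _).trans (add_le_add h1 h2.le)
    · intro ω hω
      simp only [mem_union, mem_ofPred_eq, not_or, not_not, not_lt] at hω
      -- A point of `K` within `δ/2` of the projection is within `3δ/4` of `Z n`; passing through it
      -- costs `ε` twice.
      obtain ⟨x, hxK, hx⟩ := Metric.mem_thickening_iff.1 hω.2
      have hx1 : dist x (projFin p (Z n ω)) < δ := by rw [dist_comm]; linarith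
      have hx2 : dist x (Z n ω) < δ := by
        have := dist_triangle x (projFin p (Z n ω)) (Z n ω)
        have h4 : dist (projFin p (Z n ω)) (Z n ω) ≤ δ / 4 := by
          rw [dist_comm, dist_eq_norm]; exact hω.1
        rw [dist_comm] at hx
        linarith
      have b1 := abs_le.1 (hunif' x hxK _ hx1)
      have b2 := abs_le.1 (hunif' x hxK _ hx2)
      rw [abs_le]
      constructor <;> linarith
  rw [tendsto_order]
  constructor
  · intro a ha
    obtain ⟨x, hax, hx⟩ := EReal.lt_iff_exists_real_btwn.1 ha
    rw [EReal.coe_lt_coe_iff] at hx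
    filter_upwards [main _ (sub_pos.2 hx)] with n hn
    rw [sub_sub_cancel] at hn
    exact hax.trans_le hn.1
  · intro a ha
    obtain ⟨x, hx, hax⟩ := EReal.lt_iff_exists_real_btwn.1 ha
    rw [EReal.coe_lt_coe_iff] at hx
    filter_upwards [main _ (sub_pos.2 hx)] with n hn
    rw [add_sub_cancel] at hn
    exact hn.2.trans_lt hax

end Fidi

/-! ### Existence of the limit law -/

section Nested

variable {T : Type*}

/-- Nested retractions with finite range onto finer and finer nets. -/
theorem exists_nested_retractions [Nonempty T] {τ : T → T → ℝ} (hτ : IsSemimetric τ)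
    (htb : IsTotallyBounded τ) {d : ℕ → ℝ} (hd : ∀ k, 0 < d k) :
    ∃ (I : ℕ → Finset T) (p : ∀ k, T → I k), (∀ k s, τ s (p k s) ≤ d k) ∧
      ∀ j k, j ≤ k → ∀ s, p j (p k s) = p j s := by
  choose N hN using fun k => htb (d k / 2) (half_pos (hd k))
  choose c hcN hc using hN
  -- The code records the chosen net points at all levels up to `k`, and `π k` picks one
  -- representative per code. A level-`k` code determines the coarser ones, which yields the
  -- nesting.
  set code : ∀ k, T → (Fin (k + 1) → T) := fun k s i => c i s with hcode
  set π : ℕ → T → T := fun k s => Function.invFun (code k) (code k s) with hπ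
  have hcodeπ : ∀ k s, code k (π k s) = code k s := fun k s => Function.invFun_eq ⟨s, rfl⟩
  have hrange : ∀ k, (range (π k)).Finite := by
    intro k
    have hfin : (range (code k)).Finite := by
      refine (Set.Finite.pi (t := fun i : Fin (k + 1) => (N i : Set T))
        fun i => (N i).finite_toSet).subset ?_
      rintro _ ⟨s, rfl⟩ i -
      exact hcN i s
    refine (hfin.image (Function.invFun (code k))).subset ?_
    rintro _ ⟨s, rfl⟩
    exact ⟨_, ⟨s, rfl⟩, rfl⟩
  refine ⟨fun k => (hrange k).toFinset, fun k s => ⟨π k s, by simp⟩, fun k s => ?_,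
    fun j k hjk s => Subtype.ext ?_⟩
  · have h1 : c k (π k s) = c k s := congrFun (hcodeπ k s) (Fin.last k)
    have h2 := hτ.triangle s (c k s) (π k s)
    have h3 := hc k (π k s)
    rw [h1, hτ.symm] at h3
    dsimp only
    linarith [hc k s]
  · have h1 : code j (π k s) = code j s := by
      funext i
      exact congrFun (hcodeπ k s) ⟨i, by omega⟩
    simp only [hπ] at h1 ⊢
    rw [h1]

theorem projFin_compFin_of_le {I I' : Finset T} {p : T → I} {p' : T → I'}
    (h : ∀ s, p (p' s) = p s) (x : I → ℝ) : projFin p' (compFin p x) = compFin p x := by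
  ext s
  rw [projFin_apply, compFin_apply, compFin_apply, h]

/-- Bounded functions which are uniformly approximated at prescribed rates by functions that factor
through finite sets form a compact set. -/
theorem isCompact_approx {I : ℕ → Finset T} (p : ∀ k, T → I k) (m : ℕ) (M : ℝ) {r : ℕ → ℝ}
    (hr : Tendsto r atTop (𝓝 0)) :
    IsCompact {z : EllInfty T | ‖z‖ ≤ M ∧ ∀ i, ‖z - projFin (p (m + i)) z‖ ≤ r (m + i)} := by
  rw [isCompact_iff_totallyBounded_isComplete]
  constructor
  · rw [Metric.totallyBounded_iff]
    intro ε hε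
    obtain ⟨i, hi⟩ : ∃ i, r (m + i) < ε / 2 := by
      have h1 : Tendsto (fun i => r (m + i)) atTop (𝓝 0) := by
        simpa only [add_comm m] using (tendsto_add_atTop_iff_nat m).2 hr
      exact (h1.eventually_lt_const (half_pos hε)).exists
    have hK : IsCompact (compFin (p (m + i)) '' Metric.closedBall 0 M) :=
      (isCompact_closedBall _ _).image (continuous_compFin _)
    obtain ⟨t, ht, hcov⟩ := Metric.totallyBounded_iff.1 hK.totallyBounded (ε / 2) (half_pos hε)
    refine ⟨t, ht, fun z hz => ?_⟩
    have hmem : projFin (p (m + i)) z ∈ compFin (p (m + i)) '' Metric.closedBall 0 M := by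
      refine ⟨restrictFin _ z, ?_, rfl⟩
      rw [mem_closedBall_zero_iff]
      refine (pi_norm_le_iff_of_nonneg ((norm_nonneg z).trans hz.1)).2 fun s => ?_
      exact (lp.norm_apply_le_norm (by simp) z s).trans hz.1
    obtain ⟨y, hy, hzy⟩ := mem_iUnion₂.1 (hcov hmem)
    refine mem_iUnion₂.2 ⟨y, hy, ?_⟩
    rw [Metric.mem_ball] at hzy ⊢
    have h1 := dist_triangle z (projFin (p (m + i)) z) y
    have h2 := hz.2 i
    rw [← dist_eq_norm] at h2
    linarith
  · refine IsClosed.isComplete ?_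
    rw [ofPred_and, ofPred_forall]
    exact (isClosed_le continuous_norm continuous_const).inter (isClosed_iInter fun i =>
      isClosed_le (continuous_id.sub (continuous_projFin _)).norm continuous_const)

end Nested

/-- The constant sequence `L` converges weakly to `L'`, and weak limits are unique. -/
theorem probabilityMeasure_ext_of_forall_lipschitz {E : Type*} [MeasurableSpace E]
    [PseudoMetricSpace E] [BorelSpace E] (L L' : ProbabilityMeasure E)
    (h : ∀ f : E → ℝ, (∃ C : ℝ, ∀ x y, dist (f x) (f y) ≤ C) → (∃ K, LipschitzWith K f) →
      ∫ x, f x ∂(L : Measure E) = ∫ x, f x ∂(L' : Measure E)) : L = L' := by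
  have h1 : Tendsto (fun _ : ℕ => L) atTop (𝓝 L') :=
    tendsto_iff_forall_lipschitz_integral_tendsto.2 fun f hf hf' => by
      rw [h f hf hf']
      exact tendsto_const_nhds
  exact tendsto_nhds_unique tendsto_const_nhds h1

section Existence

variable {Ω T : Type*} [MeasurableSpace Ω] {P : Measure Ω} [IsProbabilityMeasure P]
  {Z : ℕ → Ω → EllInfty T} {μ : (I : Finset T) → Measure (I → ℝ)}

/-- The law of `compFin p` under the finite-dimensional limit law. -/
noncomputable def approxLaw (hμ : ∀ I, IsProbabilityMeasure (μ I)) {I : Finset T} (p : T → I) :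
    ProbabilityMeasure (EllInfty T) :=
  ⟨(μ I).map (compFin p),
    have := hμ I
    Measure.isProbabilityMeasure_map (continuous_compFin p).measurable.aemeasurable⟩

theorem approxLaw_open_le (hZ : ∀ n t, Measurable fun ω => Z n ω t)
    (h : FidiConv P (fun n ω => (Z n ω : T → ℝ)) μ) (hμ : ∀ I, IsProbabilityMeasure (μ I))
    {I : Finset T} (p : T → I) {O : Set (EllInfty T)} (hO : IsOpen O) {η : ℝ≥0∞}
    (hη : ∀ᶠ n in atTop, P {ω | projFin p (Z n ω) ∈ O} ≤ η) :
    (approxLaw hμ p : Measure (EllInfty T)) O ≤ η := by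
  have := hμ I
  refine (Measure.map_apply (continuous_compFin p).measurable hO.measurableSet).trans_le ?_
  exact h.measure_open_le hZ I (hO.preimage (continuous_compFin p)) hη

/-- The projection is bounded in probability because its finite-dimensional limit is tight; the
remainder is small by hypothesis. -/
theorem exists_eventually_measure_lt_norm_le (hZ : ∀ n t, Measurable fun ω => Z n ω t)
    (h : FidiConv P (fun n ω => (Z n ω : T → ℝ)) μ) (hμ : ∀ I, IsProbabilityMeasure (μ I))
    {I : Finset T} {p : T → I} {r : ℝ} {η : ℝ≥0∞} (hη0 : 0 < η)
    (hη : ∀ᶠ n in atTop, P {ω | r < ‖Z n ω - projFin p (Z n ω)‖} ≤ η) :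
    ∃ M : ℝ, ∀ᶠ n in atTop, P {ω | M < ‖Z n ω‖} ≤ 2 * η := by
  have := hμ I
  obtain ⟨η', hη'0, hη'⟩ := exists_between hη0
  obtain ⟨K, hK, hμK⟩ := isTightMeasureSet_iff_exists_isCompact_measure_compl_le.1
    (isTightMeasureSet_singleton (μ := μ I)) η' hη'0
  obtain ⟨M, hM⟩ := hK.isBounded.subset_closedBall 0
  set M' := max M 0
  have hM' : (0 : ℝ) ≤ M' := le_max_right _ _
  have hG : IsClosed {x : I → ℝ | M' + 1 ≤ ‖x‖} := isClosed_le continuous_const continuous_norm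
  have hμG : μ I {x : I → ℝ | M' + 1 ≤ ‖x‖} < η := by
    refine ((measure_mono fun x hx hxK => ?_).trans (hμK _ rfl)).trans_lt hη'
    have h1 := hM hxK
    rw [mem_closedBall_zero_iff] at h1
    have h2 : M' + 1 ≤ ‖x‖ := hx
    linarith [le_max_left M 0]
  have hev := h.eventually_measure_closed_lt hZ I hG hμG
  refine ⟨M' + 1 + |r|, ?_⟩
  filter_upwards [hev, hη] with n h1 h2
  rw [two_mul]
  refine (measure_mono fun ω hω => ?_).trans
    ((measure_union_le _ _).trans (add_le_add h1.le h2))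
  by_contra hcon
  simp only [mem_union, mem_ofPred_eq, not_or, not_le, not_lt] at hcon
  have h3 : ‖projFin p (Z n ω)‖ ≤ M' + 1 := by
    refine lp.norm_le_of_forall_le (by positivity) fun s => ?_
    exact (norm_le_pi_norm (restrictFin I (Z n ω)) (p s)).trans hcon.1.le
  have h4 := norm_add_le (Z n ω - projFin p (Z n ω)) (projFin p (Z n ω))
  rw [sub_add_cancel] at h4
  have h5 : M' + 1 + |r| < ‖Z n ω‖ := hω
  linarith [le_abs_self r, hcon.2]

/-- For bounded Lipschitz `f`, letting `n → ∞` at fixed `k` shows that the integrals of `f` under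
the `J`-marginal of the `k`-th approximating law and under `μ J` differ by at most `K r k + 2 ‖φ‖ η
k`. So these integrals converge, and a cluster value must be the limit. -/
theorem marginal_eq_of_mapClusterPt (hZ : ∀ n t, Measurable fun ω => Z n ω t)
    (h : FidiConv P (fun n ω => (Z n ω : T → ℝ)) μ) (hμ : ∀ I, IsProbabilityMeasure (μ I))
    {I : ℕ → Finset T} (p : ∀ k, T → I k) {r η : ℕ → ℝ} (hr : Tendsto r atTop (𝓝 0))
    (hr0 : ∀ k, 0 ≤ r k) (hη : Tendsto η atTop (𝓝 0)) (hη0 : ∀ k, 0 ≤ η k)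
    (hev : ∀ k, ∀ᶠ n in atTop,
      P {ω | r k < ‖Z n ω - projFin (p k) (Z n ω)‖} ≤ ENNReal.ofReal (η k))
    {L : ProbabilityMeasure (EllInfty T)}
    (hL : MapClusterPt L atTop fun k => approxLaw hμ (p k)) (J : Finset T) :
    marginal (L : Measure (EllInfty T)) J = μ J := by
  have hprob := isProbabilityMeasure_marginal (L : Measure (EllInfty T)) J
  have key : (⟨marginal (L : Measure (EllInfty T)) J, hprob⟩ : ProbabilityMeasure (J → ℝ)) =
      ⟨μ J, hμ J⟩ := by
    refine probabilityMeasure_ext_of_forall_lipschitz _ _ fun f hfb hfl => ?_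
    obtain ⟨C, hC⟩ := hfb
    obtain ⟨K, hK⟩ := hfl
    let φ : (J → ℝ) →ᵇ ℝ := ⟨⟨f, hK.continuous⟩, ⟨C, hC⟩⟩
    have hφM : ∀ x, |φ x| ≤ ‖φ‖ := φ.norm_coe_le_norm
    let g : EllInfty T →ᵇ ℝ := φ.compContinuous ⟨restrictFin J, continuous_restrictFin J⟩
    have hgL : ∫ x, φ x ∂(marginal (L : Measure (EllInfty T)) J) =
        ∫ z, g z ∂(L : Measure (EllInfty T)) :=
      integral_map (continuous_restrictFin J).measurable.aemeasurable
        φ.continuous.aestronglyMeasurable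
    have hbound : ∀ k, |∫ z, g z ∂(approxLaw hμ (p k) : Measure (EllInfty T)) -
        ∫ x, φ x ∂(μ J)| ≤ K * r k + 2 * ‖φ‖ * η k := by
      intro k
      have h1 := (h (I k) (g.compContinuous ⟨compFin (p k), continuous_compFin (p k)⟩)).sub (h J φ)
      have h2 : ∫ z, g z ∂(approxLaw hμ (p k) : Measure (EllInfty T)) =
          ∫ x, g.compContinuous ⟨compFin (p k), continuous_compFin (p k)⟩ x ∂(μ (I k)) :=
        integral_map (continuous_compFin (p k)).measurable.aemeasurable
          g.continuous.aestronglyMeasurable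
      rw [h2]
      refine le_of_tendsto h1.abs ((hev k).mono fun n hn => ?_)
      have hr0k := hr0 k
      refine abs_integral_sub_integral_le
        ((g.continuous.comp (continuous_compFin (p k))).measurable.comp
          (measurable_restrictFin hZ n (I k)))
        (φ.continuous.measurable.comp (measurable_restrictFin hZ n J))
        (fun ω => hφM _) (fun ω => hφM _) (by positivity) (hη0 k) hn fun ω hω => ?_
      simp only [mem_ofPred_eq, not_lt] at hω
      have h3 := hK.dist_le_mul (restrictFin J (projFin (p k) (Z n ω))) (restrictFin J (Z n ω))
      have h4 := (lipschitzWith_restrictFin J).dist_le_mul (projFin (p k) (Z n ω)) (Z n ω)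
      rw [NNReal.coe_one, one_mul, dist_comm (projFin _ _), dist_eq_norm (Z n ω)] at h4
      exact h3.trans (mul_le_mul_of_nonneg_left (h4.trans hω) K.2)
    have hlim : Tendsto (fun k => ∫ z, g z ∂(approxLaw hμ (p k) : Measure (EllInfty T))) atTop
        (𝓝 (∫ x, φ x ∂(μ J))) := by
      rw [tendsto_iff_dist_tendsto_zero]
      refine squeeze_zero (fun _ => dist_nonneg) hbound ?_
      simpa using (hr.const_mul (K : ℝ)).add (hη.const_mul (2 * ‖φ‖))
    have hcl : MapClusterPt (∫ z, g z ∂(L : Measure (EllInfty T))) atTop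
        (fun k => ∫ z, g z ∂(approxLaw hμ (p k) : Measure (EllInfty T))) :=
      hL.continuousAt_comp
        (ProbabilityMeasure.continuous_integral_boundedContinuousFunction g).continuousAt
    refine hgL.trans (eq_of_nhds_neBot ?_)
    exact ClusterPt.mono hcl hlim
  exact congrArg (fun Q : ProbabilityMeasure (J → ℝ) => (Q : Measure (J → ℝ))) key

/-- A Prokhorov argument: the laws of the projected limits inherit norm and oscillation bounds from
`Z n`, uniformly in `k`, and so are concentrated on common compact sets. A cluster point suffices,
since its marginals are already determined. -/
theorem exists_tight_law [Nonempty T] {τ : T → T → ℝ} (hτ : IsSemimetric τ)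
    (htb : IsTotallyBounded τ) (hZ : ∀ n t, Measurable fun ω => Z n ω t)
    (haec : AEC P (fun n ω => (Z n ω : T → ℝ)) τ)
    (h : FidiConv P (fun n ω => (Z n ω : T → ℝ)) μ) (hμ : ∀ I, IsProbabilityMeasure (μ I)) :
    ∃ L : Measure (EllInfty T), IsProbabilityMeasure L ∧ IsTightMeasureSet {L} ∧
      ∀ I, marginal L I = μ I := by
  set r : ℕ → ℝ := fun k => 1 / ((k : ℝ) + 1) with hrdef
  have hr0 : ∀ k, 0 < r k := fun k => by simp only [hrdef]; positivity
  have hr : Tendsto r atTop (𝓝 0) := tendsto_one_div_add_atTop_nhds_zero_nat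
  set η : ℕ → ℝ≥0∞ := fun k => 2⁻¹ ^ k with hηdef
  have hη0 : ∀ k, 0 < η k := fun k => ENNReal.pow_pos (by simp) k
  choose δ hδ hδev using fun k => haec.exists_pos_eventually (hr0 k) (hη0 k)
  -- The running minimum makes `d k` small relative to all earlier `δ j`; the `3` pays for the
  -- three-step chain `p k s`, `s`, `p j s`, `p k (p j s)`.
  set d : ℕ → ℝ := fun k => (Finset.range (k + 1)).inf' ⟨0, by simp⟩ δ / 3 with hddef
  have hd : ∀ k, 0 < d k := fun k => by
    have : 0 < (Finset.range (k + 1)).inf' ⟨0, by simp⟩ δ :=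
      (Finset.lt_inf'_iff _).2 fun i _ => hδ i
    simp only [hddef]
    positivity
  have hdδ : ∀ j k, j ≤ k → 3 * d k ≤ δ j := fun j k hjk => by
    have := Finset.inf'_le δ (Finset.mem_range.2 (by omega : j < k + 1))
    simp only [hddef]
    linarith
  obtain ⟨I, p, hp, hnest⟩ := exists_nested_retractions hτ htb hd
  -- approximation by the projections
  have hproj : ∀ k, ∀ᶠ n in atTop, P {ω | r k < ‖Z n ω - projFin (p k) (Z n ω)‖} ≤ η k := by
    refine fun k => (hδev k).mono fun n hn => (measure_mono fun ω hω => ?_).trans hn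
    obtain ⟨s, hs⟩ := exists_lt_of_lt_norm_sub (hr0 k).le hω
    exact ⟨s, p k s, by linarith [hp k s, hdδ k k le_rfl, hd k], hs⟩
  have hosc : ∀ j k, (approxLaw hμ (p k) : Measure (EllInfty T))
      {z | r j < ‖z - projFin (p j) z‖} ≤ η j := by
    intro j k
    refine approxLaw_open_le hZ h hμ (p k) (isOpen_lt_norm_sub_projFin (p j) (r j)) ?_
    -- For `j ≤ k` the oscillation is an increment of `Z n` over distance at most `2 d k + d j ≤ δ
    -- j`. For `k < j` the nesting makes the projected path invariant under `projFin (p j)`, so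
    -- there is none.
    rcases le_or_gt j k with hjk | hjk
    · refine (hδev j).mono fun n hn => (measure_mono fun ω hω => ?_).trans hn
      obtain ⟨s, hs⟩ := exists_lt_of_lt_norm_sub (hr0 j).le hω
      refine ⟨p k s, p k (p j s), ?_, hs⟩
      have t1 := hτ.triangle (p k s) s (p k (p j s))
      have t2 := hτ.triangle s (p j s) (p k (p j s))
      have t3 := hp k s
      rw [hτ.symm] at t3
      have t4 := hp k (p j s)
      have t5 := hdδ j k hjk
      have t6 := hp j s
      have t7 := hdδ j j le_rfl
      linarith
    · refine Eventually.of_forall fun n => ?_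
      have hempty : {ω | projFin (p k) (Z n ω) ∈ {z | r j < ‖z - projFin (p j) z‖}} = ∅ := by
        refine eq_empty_of_forall_notMem fun ω hω => ?_
        have h1 : projFin (p j) (projFin (p k) (Z n ω)) = projFin (p k) (Z n ω) :=
          projFin_compFin_of_le (hnest k j hjk.le) _
        simp only [mem_ofPred_eq, h1, sub_self, norm_zero] at hω
        exact absurd hω (not_lt.2 (hr0 j).le)
      rw [hempty, measure_empty]
      exact zero_le
  choose M hM using fun m => exists_eventually_measure_lt_norm_le hZ h hμ (hη0 m) (hproj m)
  have hnorm : ∀ m k, (approxLaw hμ (p k) : Measure (EllInfty T)) {z | M m < ‖z‖} ≤ 2 * η m := by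
    intro m k
    refine approxLaw_open_le hZ h hμ (p k) (isOpen_lt continuous_const continuous_norm) ?_
    refine (hM m).mono fun n hn => (measure_mono fun ω hω => ?_).trans hn
    refine lt_of_lt_of_le hω (lp.norm_le_of_forall_le (norm_nonneg _) fun s => ?_)
    exact lp.norm_apply_le_norm (by simp) (Z n ω) (p k s)
  -- tightness and a cluster point
  set K : ℕ → Set (EllInfty T) := fun m =>
    {z | ‖z‖ ≤ M m ∧ ∀ i, ‖z - projFin (p (m + i)) z‖ ≤ r (m + i)} with hKdef
  have hK : ∀ m, IsCompact (K m) := fun m => isCompact_approx p m (M m) hr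
  -- The `4` is `2` from the norm bound plus `2` from the geometric series of oscillation bounds.
  set u : ℕ → NNReal := fun m => 4 * 2⁻¹ ^ m with hudef
  have hu : Tendsto u atTop (𝓝 0) := by
    have : Tendsto (fun m : ℕ => (2⁻¹ : NNReal) ^ m) atTop (𝓝 0) :=
      NNReal.tendsto_pow_atTop_nhds_zero_of_lt_one (inv_lt_one_of_one_lt₀ one_lt_two)
    have h4 := this.const_mul 4
    rwa [mul_zero] at h4
  have hu' : ∀ m, (u m : ℝ≥0∞) = 4 * η m := fun m => by
    simp [hudef, hηdef, ENNReal.inv_pow]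
  have hcompl : ∀ m k, (approxLaw hμ (p k) : Measure (EllInfty T)) (K m)ᶜ ≤ u m := by
    intro m k
    have hsub : (K m)ᶜ ⊆ {z | M m < ‖z‖} ∪
        ⋃ i, {z | r (m + i) < ‖z - projFin (p (m + i)) z‖} := by
      intro z hz
      simp only [hKdef, mem_compl_iff, mem_ofPred_eq, not_and_or, not_forall, not_le] at hz
      exact hz.imp id fun ⟨i, hi⟩ => mem_iUnion.2 ⟨i, hi⟩
    have hsum : ∑' i, η (m + i) = 2 * η m := by
      simp only [hηdef, pow_add]
      rw [ENNReal.tsum_mul_left, ENNReal.tsum_geometric, ENNReal.one_sub_inv_two, inv_inv, mul_comm]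
    calc (approxLaw hμ (p k) : Measure (EllInfty T)) (K m)ᶜ
        ≤ 2 * η m + ∑' i, η (m + i) :=
          (measure_mono hsub).trans ((measure_union_le _ _).trans (add_le_add (hnorm m k)
            ((measure_iUnion_le _).trans (ENNReal.tsum_le_tsum fun i => hosc _ _))))
      _ = u m := by rw [hsum, hu', ← add_mul]; norm_num
  obtain ⟨L, hLmem, hL⟩ := (isCompact_setOfPred_probabilityMeasure_mass_eq_compl_isCompact_le
    hu hK (Or.inl inferInstance)).exists_mapClusterPt (f := atTop)
    (u := fun k => approxLaw hμ (p k)) (by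
      rw [le_principal_iff, mem_map]
      refine Eventually.of_forall fun k m => ?_
      rw [← ENNReal.coe_le_coe, ProbabilityMeasure.ennreal_coeFn_eq_coeFn_toMeasure]
      exact hcompl m k)
  refine ⟨L, inferInstance, ?_, fun J => ?_⟩
  · rw [isTightMeasureSet_iff_exists_isCompact_measure_compl_le]
    intro ε hε
    have hu0 : Tendsto (fun m => (u m : ℝ≥0∞)) atTop (𝓝 0) :=
      ENNReal.tendsto_coe.2 hu
    obtain ⟨m, hm⟩ := (hu0.eventually_lt_const hε).exists
    refine ⟨K m, hK m, ?_⟩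
    rintro _ rfl
    have := hLmem m
    rw [← ENNReal.coe_le_coe, ProbabilityMeasure.ennreal_coeFn_eq_coeFn_toMeasure] at this
    exact this.trans hm.le
  · refine marginal_eq_of_mapClusterPt hZ h hμ p hr (fun k => (hr0 k).le) (η := fun k => 2⁻¹ ^ k)
      (tendsto_pow_atTop_nhds_zero_of_lt_one (by norm_num) (by norm_num)) (fun k => by positivity)
      (fun k => ?_) hL J
    rw [ENNReal.ofReal_pow (by norm_num), ENNReal.ofReal_inv_of_pos two_pos, ENNReal.ofReal_ofNat]
    exact hproj k

theorem fidiImpliesWeak_of_aec [Nonempty T] {τ : T → T → ℝ} (hτ : IsSemimetric τ)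
    (htb : IsTotallyBounded τ) (hZ : ∀ n t, Measurable fun ω => Z n ω t)
    (haec : AEC P (fun n ω => (Z n ω : T → ℝ)) τ) : FidiImpliesWeak P Z := by
  refine ⟨fun μ hμ h => ?_, fun L _ hLt h => weakConv_of_fidiConv htb hZ haec hLt h⟩
  obtain ⟨L, hL, hLt, hLm⟩ := exists_tight_law hτ htb hZ haec h hμ
  refine ⟨L, hL, hLt, hLm, weakConv_of_fidiConv htb hZ haec hLt ?_⟩
  rwa [show marginal L = μ from funext hLm]

end Existence

/-! ### The product semimetric on `[0,1] × F` -/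

section Product

variable {𝒳 : Type*} {F : Set (𝒳 → ℝ)} {ρ : F → F → ℝ}

theorem isSemimetric_productSemimetric (hρ : IsSemimetric ρ) :
    IsSemimetric (productSemimetric ρ) where
  nonneg p q := add_nonneg (abs_nonneg _) (hρ.nonneg _ _)
  self p := by simp [productSemimetric, hρ.self]
  symm p q := by simp only [productSemimetric, abs_sub_comm, hρ.symm]
  triangle p q w := by
    have h1 := abs_sub_le p.1.1 q.1.1 w.1.1
    have h2 := hρ.triangle p.2 q.2 w.2
    simp only [productSemimetric]
    linarith

theorem isTotallyBounded_productSemimetric (hρ : IsTotallyBounded ρ) :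
    IsTotallyBounded (productSemimetric ρ) := by
  classical
  intro ε hε
  obtain ⟨t, ht⟩ := hρ (ε / 2) (half_pos hε)
  obtain ⟨s, hs, hcov⟩ := Metric.totallyBounded_iff.1
    (isCompact_univ (X := Icc (0 : ℝ) 1)).totallyBounded (ε / 2) (half_pos hε)
  refine ⟨hs.toFinset ×ˢ t, fun p => ?_⟩
  obtain ⟨a, ha, hpa⟩ := mem_iUnion₂.1 (hcov (mem_univ p.1))
  obtain ⟨b, hb, hpb⟩ := ht p.2
  refine ⟨(a, b), Finset.mk_mem_product (hs.mem_toFinset.2 ha) hb, ?_⟩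
  have h1 : |p.1.1 - a.1| < ε / 2 := hpa
  simp only [productSemimetric]
  linarith

end Product

theorem measurable_seqProcessEll {Ω 𝒳 : Type*} [MeasurableSpace Ω] [MeasurableSpace 𝒳]
    {P : Measure Ω} {X : ℕ → ℕ → Ω → 𝒳} {F : Set (𝒳 → ℝ)} {Fenv : 𝒳 → ℝ}
    (hF : IsEnvelope P X F Fenv) (hX : ∀ n i, 1 ≤ i → i ≤ n → Measurable (X n i))
    (hFmeas : ∀ f ∈ F, Measurable f) (n : ℕ) (p : Icc (0 : ℝ) 1 × F) :
    Measurable fun ω => (seqProcessEll hF n ω : Icc (0 : ℝ) 1 × F → ℝ) p :=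
  (measurable_partialSum hX (hFmeas p.2.1 p.2.2) le_rfl (floor_mul_le n p.1)).const_mul _

end SeqEmp

/-! ### The main theorem -/

theorem corollary2p5 {Ω 𝒳 : Type*} [MeasurableSpace Ω] [MeasurableSpace 𝒳]
    (P : Measure Ω) [IsProbabilityMeasure P]
    -- the array `X n i`, `1 ≤ i ≤ n`, the class of functions and its envelope
    (X : ℕ → ℕ → Ω → 𝒳) (hX : ∀ n i, 1 ≤ i → i ≤ n → Measurable (X n i))
    (F : Set (𝒳 → ℝ)) (hFmeas : ∀ f ∈ F, Measurable f)
    (Fenv : 𝒳 → ℝ) (hFenv : SeqEmp.IsEnvelope P X F Fenv)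
    (ρ : F → F → ℝ) (hρ : SeqEmp.IsSemimetric ρ) (hρtb : SeqEmp.IsTotallyBounded ρ)
    (ν κ C : ℝ) (hν : 2 < ν) (hκ : 0 < κ) (hκν : κ < 1 / 2 - 1 / ν) (hC : 0 ≤ C)
    (R J : ℝ → ℝ) (hR : ∀ δ, 0 < δ → 0 ≤ R δ) (hJ : ∀ δ, 0 < δ → 0 ≤ J δ)
    (hRlim : Tendsto R (𝓝[>] 0) (𝓝 0))
    (hmoment : ∀ (δ : ℝ) (n : ℕ), 0 < δ → ∀ i j, 1 ≤ i → i ≤ j → j ≤ n →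
      SeqEmp.outerSupMoment P X (SeqEmp.differenceClass F ρ δ) ν n i j ≤
        ((SeqEmp.gammaBound C κ R J (j - i + 1) δ ^ (ν / 2) : ℝ) : EReal))
    (f₀ : 𝒳 → ℝ) (hf₀ : f₀ ∈ F) (D : ℝ) (hD : 0 < D)
    (hf₀moment : ∀ n i j : ℕ, 1 ≤ i → i ≤ j → j ≤ n →
      eLpNorm (SeqEmp.partialSum P X n i j f₀) (ENNReal.ofReal ν) P ≤
        ENNReal.ofReal (D * √((j - i + 1 : ℕ) : ℝ))) :
    (∃ (g : ℕ → ℝ → ℝ) (h : ℕ → ℝ), SeqEmp.MomentConditions P X F ρ ν g h) ∧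
    SeqEmp.AEC P (SeqEmp.seqProcess P X F) (SeqEmp.productSemimetric ρ) ∧
    SeqEmp.FidiImpliesWeak P (SeqEmp.seqProcessEll hFenv) := by
  have hν0 : 0 < 1 / ν := by positivity
  have hκ' : κ < 1 / 2 := by linarith
  have hdiff : ∀ δ, 0 < δ → ∀ n, SeqEmp.SupBound P X (SeqEmp.differenceClass F ρ δ) ν κ
      (√C * R δ) (√C * J δ) n := by
    intro δ hδ n i j hi hij hj
    have hRδ := hR δ hδ
    have hJδ := hJ δ hδ
    -- The zero function witnesses that `F_δ` is nonempty, as the passage from outer moments to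
    -- `DomLp` requires.
    have hmem : (fun x => f₀ x - f₀ x) ∈ SeqEmp.differenceClass F ρ δ :=
      ⟨⟨f₀, hf₀⟩, ⟨f₀, hf₀⟩, (hρ.self _).trans_le hδ.le, rfl⟩
    have hg := SeqEmp.growth_nonneg (κ := κ) (A := √C * R δ) (B := √C * J δ) (by positivity)
      (by positivity) (j - i + 1)
    refine SeqEmp.domLp_supSum_of_outerSupMoment_le
      ⟨_, hmem⟩ (by linarith) hg ?_
    have h := hmoment δ n hδ i j hi hij hj
    rwa [SeqEmp.gammaBound_eq_growth_sq hC hκ', ← Real.rpow_natCast, ← Real.rpow_mul hg,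
      Nat.cast_ofNat, mul_div_cancel₀ _ two_ne_zero] at h
  obtain ⟨Δ, hΔ, hball⟩ := SeqEmp.exists_semimetric_bound hρ hρtb ⟨f₀, hf₀⟩
  have hRΔ := hR Δ hΔ
  have hJΔ := hJ Δ hΔ
  have hall : ∀ n, SeqEmp.SupBound P X F ν κ (√C * R Δ + D) (√C * J Δ) n := fun n =>
    SeqEmp.supBound_all hFenv hX hFmeas hν (by positivity) (by positivity) (hdiff Δ hΔ n) hf₀ hball
      hD.le (hf₀moment n)
  have haec : SeqEmp.AEC P (SeqEmp.seqProcess P X F) (SeqEmp.productSemimetric ρ) :=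
    SeqEmp.aec_seqProcess hFenv hX hFmeas hρ hν hκ hκν
      (fun δ hδ => mul_nonneg (Real.sqrt_nonneg C) (hR δ hδ))
      (fun δ hδ => mul_nonneg (Real.sqrt_nonneg C) (hJ δ hδ))
      (by simpa using hRlim.const_mul (√C)) hdiff (by positivity) (by positivity) hall
  have : Nonempty (Icc (0 : ℝ) 1 × F) := ⟨(⟨0, by simp⟩, ⟨f₀, hf₀⟩)⟩
  exact ⟨⟨_, _, SeqEmp.momentConditions hν hκ hκν hC hR hJ hRlim hmoment (by positivity)
    (by positivity) hall⟩, haec, SeqEmp.fidiImpliesWeak_of_aec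
    (SeqEmp.isSemimetric_productSemimetric hρ) (SeqEmp.isTotallyBounded_productSemimetric hρtb)
    (SeqEmp.measurable_seqProcessEll hFenv hX hFmeas) haec⟩
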